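/- \textbf{Theorem.} There is a randomized algorithm that, given a finite simple undirected graph $G=(V,E)$, an integer $k$, and a linear arrangement $\ell$ of $G$ (a bijection from $\{1,\dots,n\}$ to $V$, where $n=|V|$), decides whether $G$ has a connected dominating set of size at most $k$, that is, a set $S\subseteq V$ with $|S|\le k$ such that every vertex of $V\setminus S$ has a neighbor in $S$ and the induced subgraph $G[S]$ is connected (and nonempty). On every input and for every outcome of its coin tosses it halts within time $p(n+b)\cdot 3^{\mathrm{ctw}}$, i.e. in time $\mathcal{O}^*(3^{\mathrm{ctw}})$; here $p$ is a fixed polynomial, $b$ is the number of bits of $|k|$, and $\mathrm{ctw}$ is the cutwidth of $\ell$, i.e. the maximum over $1\le i\le n$ of the number of edges of $G$ with one end-vertex in $\{\ell(1),\dots,\ell(i)\}$ and the other in $\{\ell(i+1),\dots,\ell(n)\}$ (and $0$ if $n=0$). The algorithm gives no false positives: if no such set $S$ exists, it never answers ``yes''. It gives false negatives with probability at most $1/2$: if such a set $S$ exists, it fails to answer ``yes'' with probability at most $1/2$. The machine model is the random access machine with logarithmic cost and fair coin tosses; the input consists of $n$, $k$, the adjacency matrix of $G$ and the arrangement $\ell$.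 -/

import Mathlib

/-! ### Graphs, linear arrangements and cutwidth -/

namespace CutwidthCDS

/-- The cut of `G` after position `i` in the linear arrangement `ℓ` (positions and vertices are
numbered `0, …, n - 1`): all edges with one end-vertex at a position `≤ i` and the other one at a
position `> i`. -/
def cut {n : ℕ} (G : SimpleGraph (Fin n)) (ℓ : Equiv.Perm (Fin n)) (i : Fin n) :
    Set (Sym2 (Fin n)) :=
  {e | e ∈ G.edgeSet ∧ ∃ j k : Fin n, j ≤ i ∧ i < k ∧ e = s(ℓ j, ℓ k)}

/-- The cutwidth of a linear arrangement: the largest number of edges in a cut. -/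
noncomputable def cutwidth {n : ℕ} (G : SimpleGraph (Fin n)) (ℓ : Equiv.Perm (Fin n)) : ℕ :=
  Finset.univ.sup fun i => (cut G ℓ i).ncard

/-- `S` is a dominating set: every vertex outside `S` has a neighbor in `S`. -/
def IsDominating {n : ℕ} (G : SimpleGraph (Fin n)) (S : Finset (Fin n)) : Prop :=
  ∀ v, v ∉ S → ∃ u ∈ S, G.Adj v u

/-- The yes-instances of Connected Dominating Set: there is a dominating set of cardinality at
most `k` that induces a connected (in particular nonempty) subgraph. -/
def HasCDS {n : ℕ} (G : SimpleGraph (Fin n)) (k : ℤ) : Prop :=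
  ∃ S : Finset (Fin n),
    IsDominating G S ∧ (S.card : ℤ) ≤ k ∧ (G.induce (S : Set (Fin n))).Connected

/-! ### Randomized random access machines with logarithmic cost

A program works on finitely many arrays of natural numbers, named by numerals in the program text
and of unbounded length, with indirect addressing and structured control flow, and it may toss
fair coins.  Every operation is charged the bit lengths of all addresses and all values that it
handles, so that large numbers cannot be used to hide work. -/

/-- Arithmetic operations; `sub` is truncated, `x / 0 = 0`, `x % 0 = x`. -/
inductive Op
  | add | sub | mul | div | mod | eq | lt

/-- The value of an operation; comparisons return `1` or `0`. -/
def Op.eval : Op → ℕ → ℕ → ℕ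
  | .add, x, y => x + y
  | .sub, x, y => x - y
  | .mul, x, y => x * y
  | .div, x, y => x / y
  | .mod, x, y => x % y
  | .eq, x, y => if x = y then 1 else 0
  | .lt, x, y => if x < y then 1 else 0

/-- A memory: `m a i` is the content of cell `i` of array `a`. -/
abbrev Memory := ℕ → ℕ → ℕ

/-- Expressions: literals, reading a cell of a fixed array at a computed index, operations. -/
inductive Expr
  | lit (c : ℕ)
  | read (a : ℕ) (index : Expr)
  | op (o : Op) (e₁ e₂ : Expr)

/-- The value of an expression. -/
def Expr.val (m : Memory) : Expr → ℕ
  | .lit c => c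
  | .read a e => m a (e.val m)
  | .op o e₁ e₂ => o.eval (e₁.val m) (e₂.val m)

/-- The cost of evaluating an expression. -/
def Expr.cost (m : Memory) : Expr → ℕ
  | .lit c => 1 + c.size
  | .read a e => e.cost m + (1 + (e.val m).size + (m a (e.val m)).size)
  | .op _ e₁ e₂ => e₁.cost m + e₂.cost m + (1 + (e₁.val m).size + (e₂.val m).size)

/-- Programs.  `write a e₁ e₂` stores the value of `e₂` in cell `e₁` of array `a`;
`toss a e` stores a fresh random bit in cell `e` of array `a`; a condition holds if its value is
nonzero. -/
inductive Prog
  | skip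
  | write (a : ℕ) (index value : Expr)
  | toss (a : ℕ) (index : Expr)
  | seq (p q : Prog)
  | ite (c : Expr) (p q : Prog)
  | while (c : Expr) (p : Prog)

/-- Changing one cell of the memory. -/
def Memory.set (m : Memory) (a i x : ℕ) : Memory :=
  Function.update m a (Function.update (m a) i x)

/-- A configuration: the memory, and the number of coins tossed so far. -/
structure Config where
  mem : Memory
  tossed : ℕ

/-- `Exec ω p s t s'`: if the coin tosses have the outcomes `ω 0, ω 1, …`, then the program `p`,
started in the configuration `s`, halts in the configuration `s'` after time exactly `t`. -/
inductive Exec (ω : ℕ → Bool) : Prog → Config → ℕ → Config → Prop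
  | skip (s : Config) : Exec ω .skip s 1 s
  | write (a : ℕ) (e₁ e₂ : Expr) (s : Config) :
      Exec ω (.write a e₁ e₂) s
        (e₁.cost s.mem + e₂.cost s.mem + (1 + (e₁.val s.mem).size + (e₂.val s.mem).size))
        ⟨s.mem.set a (e₁.val s.mem) (e₂.val s.mem), s.tossed⟩
  | toss (a : ℕ) (e : Expr) (s : Config) :
      Exec ω (.toss a e) s (e.cost s.mem + (1 + (e.val s.mem).size))
        ⟨s.mem.set a (e.val s.mem) (ω s.tossed).toNat, s.tossed + 1⟩
  | seq {p q : Prog} {s s' s'' : Config} {t t' : ℕ} (h : Exec ω p s t s')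
      (h' : Exec ω q s' t' s'') : Exec ω (.seq p q) s (t + t') s''
  | ite_true {c : Expr} {p q : Prog} {s s' : Config} {t : ℕ} (hc : c.val s.mem ≠ 0)
      (h : Exec ω p s t s') : Exec ω (.ite c p q) s (c.cost s.mem + 1 + t) s'
  | ite_false {c : Expr} {p q : Prog} {s s' : Config} {t : ℕ} (hc : c.val s.mem = 0)
      (h : Exec ω q s t s') : Exec ω (.ite c p q) s (c.cost s.mem + 1 + t) s'
  | while_true {c : Expr} {p : Prog} {s s' s'' : Config} {t t' : ℕ} (hc : c.val s.mem ≠ 0)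
      (h : Exec ω p s t s') (h' : Exec ω (.while c p) s' t' s'') :
      Exec ω (.while c p) s (c.cost s.mem + 1 + t + t') s''
  | while_false {c : Expr} {p : Prog} {s : Config} (hc : c.val s.mem = 0) :
      Exec ω (.while c p) s (c.cost s.mem + 1) s

/-- For given coin tosses, running time and result of a program are unique. -/
theorem Exec.unique {ω : ℕ → Bool} {p : Prog} {s s₁ : Config} {t₁ : ℕ} (h₁ : Exec ω p s t₁ s₁) :
    ∀ {t₂ : ℕ} {s₂ : Config}, Exec ω p s t₂ s₂ → t₁ = t₂ ∧ s₁ = s₂ := by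
  induction h₁ with
  | skip | write | toss => intro _ _ h; cases h; exact ⟨rfl, rfl⟩
  | seq _ _ ih ih' =>
    intro _ _ h
    cases h with
    | seq g g' =>
      obtain ⟨rfl, rfl⟩ := ih g
      obtain ⟨rfl, rfl⟩ := ih' g'
      exact ⟨rfl, rfl⟩
  | ite_true hc _ ih =>
    intro _ _ h
    cases h with
    | ite_true _ g => obtain ⟨rfl, rfl⟩ := ih g; exact ⟨rfl, rfl⟩
    | ite_false hc' _ => exact absurd hc' hc
  | ite_false hc _ ih =>
    intro _ _ h
    cases h with
    | ite_true hc' _ => exact absurd hc hc'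
    | ite_false _ g => obtain ⟨rfl, rfl⟩ := ih g; exact ⟨rfl, rfl⟩
  | while_true hc _ _ ih ih' =>
    intro _ _ h
    cases h with
    | while_true _ g g' =>
      obtain ⟨rfl, rfl⟩ := ih g
      obtain ⟨rfl, rfl⟩ := ih' g'
      exact ⟨rfl, rfl⟩
    | while_false hc' => exact absurd hc' hc
  | while_false hc =>
    intro _ _ h
    cases h with
    | while_true hc' _ _ => exact absurd hc hc'
    | while_false _ => exact ⟨rfl, rfl⟩

/-- The program halts within time `T`, started on the memory `m`, with coin tosses `ω`. -/
def HaltsWithin (p : Prog) (m : Memory) (ω : ℕ → Bool) (T : ℕ) : Prop :=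
  ∃ t s, Exec ω p ⟨m, 0⟩ t s ∧ t ≤ T

/-- The program halts with the answer "yes", a nonzero number in cell `0` of array `3`. -/
def Accepts (p : Prog) (m : Memory) (ω : ℕ → Bool) : Prop :=
  ∃ t s, Exec ω p ⟨m, 0⟩ t s ∧ s.mem 3 0 ≠ 0

/-- The law of an infinite sequence of independent tosses of a fair coin. -/
noncomputable def coinMeasure : MeasureTheory.Measure (ℕ → Bool) :=
  MeasureTheory.Measure.infinitePi fun _ => (PMF.uniformOfFintype Bool).toMeasure

/-! ### The input -/

open Classical in
/-- The initial memory.  Array `0` holds the number `n` of vertices, the absolute value of `k` and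
the sign of `k`; array `1` the adjacency matrix, row by row; array `2` the linear arrangement.
All other cells are zero. -/
noncomputable def input {n : ℕ} (G : SimpleGraph (Fin n)) (ℓ : Equiv.Perm (Fin n)) (k : ℤ) :
    Memory
  | 0, 0 => n
  | 0, 1 => k.natAbs
  | 0, 2 => if k < 0 then 1 else 0
  | 1, i => if ∃ u v : Fin n, i = n * u + v ∧ G.Adj u v then 1 else 0
  | 2, i => if h : i < n then (ℓ ⟨i, h⟩ : ℕ) else 0
  | _, _ => 0

/-- The size of an instance: the number of vertices plus the number of bits of `k`.  The number of
bits of the input is bounded by a polynomial in it, and conversely. -/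
def inputSize (n : ℕ) (k : ℤ) : ℕ := n + k.natAbs.size

end CutwidthCDS

/-! The method is Cut and Count. Fix a root `r` and give each vertex one of four states, where
adjacent vertices must have equal states unless one of the two is `3`, and `r` must have state `0`.
Sum over all such assignments the product of indeterminate weights of the chosen vertices, those in
state `0` or `1`. In characteristic two only the connected dominating sets containing `r` survive,
each exactly once (`partition_eq`). An unchosen vertex without chosen neighbor can switch between
`2` and `3`, and the chosen vertices not connected to `r` can switch together between `0` and `1`;
in either case the terms cancel in pairs. If the chosen set is connected and dominating, the root
forces `0` on all of it and `3` outside.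

The base `3` comes from a factorization: modulo 2 the four by four compatibility matrix is `bond`, a
sum over three values `r` of `spin s' r * spin s r`. An edge across the current cut is therefore
remembered by one ternary digit. Reaching its second end-vertex contracts the digit
(`entry_contract`), reaching its first one creates it (`entry_expand`). Digits sit in reusable
slots; since the lowest free slot is taken, and only after all edges to earlier vertices were
released, the table never exceeds `3 ^ ctw` indices (`card_activeEdges_lt`, `card_activeEdges_le`).

The weights are random polynomials over `ZMod 2` of degree below `n`, times `X ^ (n * n)`. The shift
puts sets of different cardinalities into disjoint blocks of exponents. For one cardinality the sum
is a polynomial in the weights, nonzero if a solution of this size exists, and Schwartz-Zippel over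
the domain `(ZMod 2)[X]` bounds the failure probability by `n / 2 ^ n` (`two_mul_card_failures_le`).
A false positive is impossible, because a nonzero coefficient needs a summand. The machine works
with natural numbers: the polynomials are evaluated at an even base above all their coefficients, so
parities of digits are the coefficients modulo 2 (`partition_div_pow_mod_two`). -/

namespace CutwidthCDS

/-! ### Size and cost of expressions -/

/-- All cells of the memory hold numbers with at most `b` bits. -/
def Bounded (b : ℕ) (m : Memory) : Prop := ∀ a i, m a i < 2 ^ b

/-- `e.weight * b` bounds the bit length of the value of `e` on a memory with cells of `b` bits. -/
def Expr.weight : Expr → ℕ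
  | .lit c => c
  | .read _ _ => 1
  | .op _ e₁ e₂ => e₁.weight + e₂.weight + 1

/-- `e.charge * b` bounds the cost of `e` on a memory with cells of `b` bits. -/
def Expr.charge : Expr → ℕ
  | .lit c => 1 + c
  | .read _ e => e.charge + (1 + e.weight + 1)
  | .op _ e₁ e₂ => e₁.charge + e₂.charge + (1 + e₁.weight + e₂.weight)

theorem Op.size_eval_le (o : Op) (x y : ℕ) : (o.eval x y).size ≤ x.size + y.size + 1 := by
  have hx := Nat.lt_size_self x
  have hy := Nat.lt_size_self y
  have le_of_le : ∀ z, z ≤ x → z.size ≤ x.size + y.size + 1 := fun z hz =>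
    (Nat.size_le_size hz).trans (by omega)
  have le_of_le_one : ∀ z, z ≤ 1 → z.size ≤ x.size + y.size + 1 := fun z hz =>
    (Nat.size_le_size hz).trans (by rw [Nat.size_one]; omega)
  cases o with
  | add =>
    rw [Nat.size_le, Op.eval, pow_succ, pow_add]
    have := Nat.one_le_two_pow (n := x.size)
    have := Nat.one_le_two_pow (n := y.size)
    nlinarith
  | sub => exact le_of_le _ (Nat.sub_le _ _)
  | mul =>
    refine le_trans ?_ (Nat.le_succ _)
    rw [Nat.size_le, Op.eval, pow_add]
    exact Nat.mul_lt_mul'' hx hy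
  | div => exact le_of_le _ (Nat.div_le_self _ _)
  | mod => exact le_of_le _ (Nat.mod_le _ _)
  | eq => exact le_of_le_one _ (by rw [Op.eval]; split <;> omega)
  | lt => exact le_of_le_one _ (by rw [Op.eval]; split <;> omega)

theorem size_le_self (c : ℕ) : c.size ≤ c := Nat.size_le.2 c.lt_two_pow_self

theorem Expr.size_val_le {b : ℕ} (hb : 1 ≤ b) {m : Memory} (hm : Bounded b m) (e : Expr) :
    (e.val m).size ≤ e.weight * b := by
  induction e with
  | lit c => exact (size_le_self c).trans (Nat.le_mul_of_pos_right _ hb)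
  | read a e _ => simpa [Expr.weight, Expr.val] using Nat.size_le.2 (hm _ _)
  | op o e₁ e₂ h₁ h₂ =>
    refine (o.size_eval_le _ _).trans ?_
    simp only [Expr.weight]
    nlinarith

theorem Expr.cost_le {b : ℕ} (hb : 1 ≤ b) {m : Memory} (hm : Bounded b m) (e : Expr) :
    e.cost m ≤ e.charge * b := by
  induction e with
  | lit c =>
    have := size_le_self c
    simp only [Expr.cost, Expr.charge]
    nlinarith
  | read a e h =>
    have := Nat.size_le.2 (hm a (e.val m))
    have := e.size_val_le hb hm
    simp only [Expr.cost, Expr.charge]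
    nlinarith
  | op o e₁ e₂ h₁ h₂ =>
    have := e₁.size_val_le hb hm
    have := e₂.size_val_le hb hm
    simp only [Expr.cost, Expr.charge]
    nlinarith

/-! ### Memory and frames -/

theorem Memory.set_apply (m : Memory) (a i x a' i' : ℕ) :
    m.set a i x a' i' = if a' = a ∧ i' = i then x else m a' i' := by
  unfold Memory.set
  by_cases h : a' = a
  · subst h; by_cases h' : i' = i <;> simp [h']
  · simp [h]

@[simp] theorem Memory.set_ne (m : Memory) {a a' : ℕ} (i x : ℕ) (h : a' ≠ a) :
    m.set a i x a' = m a' := by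
  simp [Memory.set, h]

@[simp] theorem Memory.set_self (m : Memory) (a i x i' : ℕ) :
    m.set a i x a i' = if i' = i then x else m a i' := by
  simp [Memory.set_apply]

/-- The arrays that a program may modify. -/
def Prog.touches : Prog → List ℕ
  | .skip => []
  | .write a _ _ => [a]
  | .toss a _ => [a]
  | .seq p q => p.touches ++ q.touches
  | .ite _ p q => p.touches ++ q.touches
  | .while _ p => p.touches

/-- The arrays that `p` does not touch are the same in both configurations. -/
def Frame (p : Prog) (s s' : Config) : Prop := ∀ a, a ∉ p.touches → s'.mem a = s.mem a

/-- The touched arrays are visible in the program text, so later "this array has not changed"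
becomes non-membership in a list of numerals, mostly settled by `decide`. -/
theorem Exec.frame {ω : ℕ → Bool} {p : Prog} {s s' : Config} {t : ℕ} (h : Exec ω p s t s') :
    Frame p s s' := by
  induction h with
  | skip => exact fun _ _ => rfl
  | write | toss => exact fun a ha => Memory.set_ne _ _ _ (by simpa [Prog.touches] using ha)
  | seq _ _ h h' =>
    intro a ha
    simp only [Prog.touches, List.mem_append, not_or] at ha
    rw [h' a ha.2, h a ha.1]
  | ite_true _ _ h =>
    intro a ha
    simp only [Prog.touches, List.mem_append, not_or] at ha
    exact h a ha.1
  | ite_false _ _ h =>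
    intro a ha
    simp only [Prog.touches, List.mem_append, not_or] at ha
    exact h a ha.2
  | while_true _ _ _ h h' => exact fun a ha => (h' a ha).trans (h a ha)
  | while_false => exact fun _ _ => rfl

theorem Frame.refl (p : Prog) (s : Config) : Frame p s s := fun _ _ => rfl

theorem Frame.trans {p : Prog} {s s' s'' : Config} (h : Frame p s s') (h' : Frame p s' s'') :
    Frame p s s'' := fun a ha => (h' a ha).trans (h a ha)

/-! ### A total-correctness logic with running times

Atomic steps are charged `1`; the unit is `1000 * b`, where `b` bounds the bit length of all cells
of the memory. -/

/-- From `s`, the program halts in a configuration with `Q` within `N` units of time. -/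
def Wp (ω : ℕ → Bool) (b : ℕ) (p : Prog) (s : Config) (N : ℕ) (Q : Config → Prop) : Prop :=
  Bounded b s.mem → ∃ t s', Exec ω p s t s' ∧ t ≤ N * (1000 * b) ∧ Bounded b s'.mem ∧ Q s'

section Rules

variable {ω : ℕ → Bool} {b : ℕ}

theorem Wp.weaken {p : Prog} {s : Config} {N N' : ℕ} {Q Q' : Config → Prop}
    (h : Wp ω b p s N Q) (hN : N ≤ N') (hQ : ∀ s', Frame p s s' → Q s' → Q' s') :
    Wp ω b p s N' Q' := by
  intro hs
  obtain ⟨t, s', he, ht, hb, hq⟩ := h hs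
  exact ⟨t, s', he, ht.trans (Nat.mul_le_mul_right _ hN), hb, hQ s' he.frame hq⟩

theorem Wp.of_bounded {p : Prog} {s : Config} {N : ℕ} {Q : Config → Prop}
    (h : Bounded b s.mem → Wp ω b p s N Q) : Wp ω b p s N Q := fun hs => h hs hs

theorem Bounded.set {m : Memory} (hm : Bounded b m) {x : ℕ} (hx : x < 2 ^ b) (a i : ℕ) :
    Bounded b (m.set a i x) := by
  intro a' i'
  rw [Memory.set_apply]
  split
  · exact hx
  · exact hm _ _

theorem Wp.skip {s : Config} {Q : Config → Prop} (hb : 1 ≤ b) (hQ : Q s) :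
    Wp ω b .skip s 1 Q := fun hs =>
  ⟨1, s, .skip s, by omega, hs, hQ⟩

theorem Wp.write {a : ℕ} {e₁ e₂ : Expr} {s : Config} {Q : Config → Prop} (hb : 1 ≤ b)
    (hc : e₁.charge + e₂.charge + (1 + e₁.weight + e₂.weight) ≤ 1000)
    (hv : e₂.val s.mem < 2 ^ b)
    (hQ : Q ⟨s.mem.set a (e₁.val s.mem) (e₂.val s.mem), s.tossed⟩) :
    Wp ω b (.write a e₁ e₂) s 1 Q := by
  intro hs
  refine ⟨_, _, .write a e₁ e₂ s, ?_, hs.set hv _ _, hQ⟩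
  have h₁ := e₁.cost_le hb hs
  have h₂ := e₂.cost_le hb hs
  have h₃ := e₁.size_val_le hb hs
  have h₄ := e₂.size_val_le hb hs
  have := Nat.mul_le_mul_right b hc
  nlinarith

theorem Wp.toss {a : ℕ} {e : Expr} {s : Config} {Q : Config → Prop} (hb : 1 ≤ b)
    (hc : e.charge + (1 + e.weight) ≤ 1000)
    (hQ : Q ⟨s.mem.set a (e.val s.mem) (ω s.tossed).toNat, s.tossed + 1⟩) :
    Wp ω b (.toss a e) s 1 Q := by
  intro hs
  refine ⟨_, _, .toss a e s, ?_, hs.set ?_ _ _, hQ⟩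
  · have h₁ := e.cost_le hb hs
    have h₃ := e.size_val_le hb hs
    have := Nat.mul_le_mul_right b hc
    nlinarith
  · exact lt_of_le_of_lt (Bool.toNat_le _) (Nat.one_lt_two_pow (by omega))

theorem Wp.seq {p q : Prog} {s : Config} {N N' : ℕ} {Q R : Config → Prop}
    (hp : Wp ω b p s N R) (hq : ∀ s', Frame p s s' → R s' → Wp ω b q s' N' Q) :
    Wp ω b (.seq p q) s (N + N') Q := by
  intro hs
  obtain ⟨t, s', he, ht, hb, hr⟩ := hp hs
  obtain ⟨t', s'', he', ht', hb', hq⟩ := hq s' he.frame hr hb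
  exact ⟨_, s'', .seq he he', by rw [add_mul]; omega, hb', hq⟩

theorem Wp.ite {c : Expr} {p q : Prog} {s : Config} {N : ℕ} {Q : Config → Prop} (hb : 1 ≤ b)
    (hc : c.charge + 1 ≤ 1000) (hp : c.val s.mem ≠ 0 → Wp ω b p s N Q)
    (hq : c.val s.mem = 0 → Wp ω b q s N Q) : Wp ω b (.ite c p q) s (N + 1) Q := by
  intro hs
  have h₁ := c.cost_le hb hs
  have h₂ := Nat.mul_le_mul_right b hc
  by_cases h : c.val s.mem = 0
  · obtain ⟨t, s', he, ht, hb, hr⟩ := hq h hs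
    exact ⟨_, s', .ite_false h he, by nlinarith, hb, hr⟩
  · obtain ⟨t, s', he, ht, hb, hr⟩ := hp h hs
    exact ⟨_, s', .ite_true h he, by nlinarith, hb, hr⟩

/-- The rule for a loop that makes at most `M` iterations. -/
theorem Wp.while {c : Expr} {p : Prog} {s : Config} {N M : ℕ} {Q : Config → Prop}
    (I : ℕ → Config → Prop) (hb : 1 ≤ b) (hc : c.charge + 1 ≤ 1000) (h0 : I 0 s)
    (hstep : ∀ i s', Frame p s s' → I i s' → c.val s'.mem ≠ 0 →
      i < M ∧ Wp ω b p s' N (I (i + 1)))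
    (hend : ∀ i s', Frame p s s' → I i s' → c.val s'.mem = 0 → Q s') :
    Wp ω b (.while c p) s (M * (N + 1) + 1) Q := by
  -- Induction on the number `k` of iterations still allowed. For `k = 0` the condition must fail,
  -- as `hstep` would otherwise give `i < M`.
  have key : ∀ k i s', i + k = M → Frame p s s' → I i s' →
      Wp ω b (.while c p) s' (k * (N + 1) + 1) Q := by
    intro k
    induction k with
    | zero =>
      intro i s' hi hf hI hs
      have h₁ := c.cost_le hb hs
      have h₂ := Nat.mul_le_mul_right b hc
      by_cases h : c.val s'.mem = 0
      · exact ⟨_, s', .while_false h, by nlinarith, hs, hend i s' hf hI h⟩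
      · exact absurd (hstep i s' hf hI h).1 (by omega)
    | succ k ih =>
      intro i s' hi hf hI hs
      have h₁ := c.cost_le hb hs
      have h₂ := Nat.mul_le_mul_right b hc
      by_cases h : c.val s'.mem = 0
      · exact ⟨_, s', .while_false h, (show _ ≤ 1000 * b by nlinarith).trans
            (Nat.le_mul_of_pos_left _ (by omega)), hs, hend i s' hf hI h⟩
      · obtain ⟨t, s₁, he, ht, hb₁, hr⟩ := (hstep i s' hf hI h).2 hs
        obtain ⟨t', s₂, he', ht', hb₂, hr'⟩ :=
          ih (i + 1) s₁ (by omega) (hf.trans he.frame) hr hb₁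
        exact ⟨_, s₂, .while_true h he he', by nlinarith, hb₂, hr'⟩
  exact key M 0 s (by omega) (Frame.refl _ _) h0

/-! ### Counting loops -/

/-- Reading the variable kept in cell `0` of array `a`. -/
def Expr.var (a : ℕ) : Expr := .read a (.lit 0)

@[simp] theorem Expr.val_var (m : Memory) (a : ℕ) : (Expr.var a).val m = m a 0 := rfl

/-- Assignment to the variable kept in cell `0` of array `a`. -/
def Prog.assign (a : ℕ) (e : Expr) : Prog := .write a (.lit 0) e

theorem Wp.assign {a : ℕ} {e : Expr} {s : Config} {Q : Config → Prop} (hb : 1 ≤ b)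
    (hc : e.charge + e.weight ≤ 998) (hv : e.val s.mem < 2 ^ b)
    (hQ : Q ⟨s.mem.set a 0 (e.val s.mem), s.tossed⟩) :
    Wp ω b (.assign a e) s 1 Q :=
  Wp.write hb (by simp only [Expr.charge, Expr.weight]; omega) hv hQ

/-- `for a in range hi do p`. -/
def Prog.loop (a : ℕ) (hi : Expr) (p : Prog) : Prog :=
  .seq (.assign a (.lit 0))
    (.while (.op .lt (.var a) hi) (.seq p (.assign a (.op .add (.var a) (.lit 1)))))

theorem Wp.loop {a : ℕ} {hi : Expr} {p : Prog} {s : Config} {N : ℕ} {Q : Config → Prop}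
    (I : ℕ → Config → Prop) (M : ℕ) (hb : 1 ≤ b) (hc : hi.charge + hi.weight ≤ 990)
    (hM : M < 2 ^ b) (hhi : ∀ s', Frame (.loop a hi p) s s' → hi.val s'.mem = M)
    (h0 : I 0 ⟨s.mem.set a 0 0, s.tossed⟩)
    (hstep : ∀ i s', i < M → Frame (.loop a hi p) s s' → s'.mem a 0 = i → I i s' →
      Wp ω b p s' N
        (fun s'' => s''.mem a 0 = i ∧ I (i + 1) ⟨s''.mem.set a 0 (i + 1), s''.tossed⟩))
    (hend : ∀ s', I M s' → s'.mem a 0 = M → Q s') :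
    Wp ω b (.loop a hi p) s (M * (N + 2) + 2) Q := by
  have hpos : 0 < 2 ^ b := by positivity
  have hframe : ∀ s' : Config, Frame
      (.seq p (.assign a (.op .add (.var a) (.lit 1)))) ⟨s.mem.set a 0 0, s.tossed⟩ s' →
      Frame (.loop a hi p) s s' := by
    intro s' h x hx
    simp only [Prog.loop, Prog.touches, Prog.assign, List.mem_append, List.mem_cons,
      List.not_mem_nil, or_false, not_or] at hx
    rw [h x (by simpa [Prog.touches, Prog.assign] using hx.2)]
    exact Memory.set_ne _ _ _ hx.1
  refine (Wp.seq (N := 1) (N' := M * (N + 1 + 1) + 1)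
    (R := fun s' => s' = ⟨s.mem.set a 0 0, s.tossed⟩)
    (Wp.assign (e := .lit 0) hb (by simp [Expr.charge, Expr.weight]) (by simp [Expr.val])
      rfl) ?_).weaken (by ring_nf; rfl)
    (fun _ _ h => h)
  rintro s₁ - rfl
  refine Wp.while (fun i s' => i ≤ M ∧ s'.mem a 0 = i ∧ I i s') hb ?_ ?_ ?_ ?_
  · simp only [Expr.charge, Expr.weight, Expr.var]; omega
  · exact ⟨Nat.zero_le _, by simp, h0⟩
  · rintro i s' hf ⟨hi', hai, hI⟩ hv
    have hf' := hframe s' hf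
    have hlt : i < M := by
      simp only [Expr.val, Op.eval, Expr.val_var, hhi s' hf', hai] at hv
      by_contra h
      simp [h] at hv
    refine ⟨hlt, Wp.seq (hstep i s' hlt hf' hai hI) ?_⟩
    rintro s₂ - ⟨ha₂, hI₂⟩
    have hval : (Expr.op .add (.var a) (.lit 1)).val s₂.mem = i + 1 := by
      simp [Expr.val, Op.eval, ha₂]
    refine Wp.assign hb (by simp [Expr.charge, Expr.weight, Expr.var]) ?_ ?_
    · rw [hval]; omega
    · rw [hval]; exact ⟨hlt, by simp, hI₂⟩
  · rintro i s' hf ⟨hi', hai, hI⟩ hv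
    have hf' := hframe s' hf
    simp only [Expr.val, Op.eval, Expr.val_var, hhi s' hf', hai] at hv
    have : i = M := by
      by_contra h
      simp [show i < M by omega] at hv
    subst this
    exact hend s' hI hai

/-- Filling the cells `0, …, M - 1` of an array. -/
theorem Wp.fill {a d : ℕ} {hi e : Expr} {s : Config} (had : a ≠ d) (f : ℕ → ℕ) (M : ℕ)
    (hb : 1 ≤ b) (hc : hi.charge + hi.weight ≤ 990) (hc' : e.charge + e.weight ≤ 990)
    (hM : M < 2 ^ b)
    (hhi : ∀ s' : Config, (∀ x, x ≠ a → x ≠ d → s'.mem x = s.mem x) → hi.val s'.mem = M)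
    (hf : ∀ i < M, f i < 2 ^ b)
    (he : ∀ i < M, ∀ s' : Config, (∀ x, x ≠ a → x ≠ d → s'.mem x = s.mem x) → s'.mem a 0 = i →
      e.val s'.mem = f i) :
    Wp ω b (.loop a hi (.write d (.var a) e)) s (M * 3 + 2)
      (fun s' => s'.tossed = s.tossed ∧ ∀ i < M, s'.mem d i = f i) := by
  have hframe : ∀ s', Frame (.loop a hi (.write d (.var a) e)) s s' →
      ∀ x, x ≠ a → x ≠ d → s'.mem x = s.mem x := by
    intro s' h x hx hx'
    exact h x (by simp [Prog.loop, Prog.touches, Prog.assign, hx, hx'])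
  refine Wp.loop (fun i s' => s'.tossed = s.tossed ∧ ∀ j < i, s'.mem d j = f j) M hb hc hM
    (fun s' h => hhi s' (hframe s' h)) (by simp) ?_ (fun s' h _ => h)
  intro i s' hi hf' hai hI
  have hv := he i hi s' (hframe s' hf') hai
  refine Wp.write hb (by simp only [Expr.charge, Expr.weight, Expr.var]; omega)
    (hv ▸ hf i hi) ?_
  refine ⟨by simp [had, hai], hI.1, fun j hj => ?_⟩
  simp only [Memory.set_ne _ _ _ had.symm, Memory.set_self, hv, Expr.val_var, hai]
  split
  · simp_all
  · exact hI.2 j (by omega)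

end Rules

open Finset

/-! ### Sums over states of vertices -/

/-- The sum of `f σ` over all `σ` with values below `4` that vanish from `v` on. -/
def stateSum {R : Type*} [CommSemiring R] : ℕ → ((ℕ → ℕ) → R) → R
  | 0, f => f fun _ => 0
  | v + 1, f => stateSum v fun σ => ∑ s ∈ range 4, f (Function.update σ v s)

section StateSum

variable {R : Type*} [CommSemiring R]

theorem stateSum_mul (c : R) (v : ℕ) (f : (ℕ → ℕ) → R) :
    c * stateSum v f = stateSum v fun σ => c * f σ := by
  induction v generalizing f with
  | zero => rfl
  | succ v ih => simp only [stateSum, ih, mul_sum]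

theorem stateSum_sum {ι : Type*} (S : Finset ι) (v : ℕ) (f : ι → (ℕ → ℕ) → R) :
    ∑ i ∈ S, stateSum v (f i) = stateSum v fun σ => ∑ i ∈ S, f i σ := by
  induction v generalizing f with
  | zero => rfl
  | succ v ih =>
    simp only [stateSum, ih]
    congr 1
    funext σ
    exact sum_comm

theorem stateSum_zero (v : ℕ) : stateSum v (fun _ => (0 : R)) = 0 := by
  simpa using (stateSum_mul (0 : R) v fun _ => 0).symm

theorem map_stateSum {S : Type*} [CommSemiring S] (φ : R →+* S) (v : ℕ) (f : (ℕ → ℕ) → R) :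
    φ (stateSum v f) = stateSum v fun σ => φ (f σ) := by
  induction v generalizing f with
  | zero => rfl
  | succ v ih => simp only [stateSum, ih, map_sum]

theorem stateSum_le {v : ℕ} {f : (ℕ → ℕ) → ℕ} {B : ℕ} (h : ∀ σ, f σ ≤ B) :
    stateSum v f ≤ 4 ^ v * B := by
  induction v generalizing f B with
  | zero => simpa [stateSum] using h _
  | succ v ih =>
    rw [stateSum, pow_succ, mul_assoc]
    refine ih fun σ => (sum_le_sum fun s _ => h _).trans ?_
    simp

/-- The recursive form adds one vertex at a time, as the program does; this form is the one in which
assignments can be paired off. -/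
theorem stateSum_eq_sum (n : ℕ) (f : (ℕ → ℕ) → R) :
    stateSum n f = ∑ σ : Fin n → Fin 4, f fun i => if h : i < n then σ ⟨i, h⟩ else 0 := by
  induction n generalizing f with
  | zero => simp [stateSum]
  | succ n ih =>
    rw [stateSum, ih, ← Equiv.sum_comp (Fin.snocEquiv fun _ : Fin (n + 1) => Fin 4),
      Fintype.sum_prod_type_right]
    refine Fintype.sum_congr _ _ fun σ => ?_
    rw [sum_range]
    refine Fintype.sum_congr _ _ fun s => ?_
    congr 1
    funext i
    rcases lt_trichotomy i n with h | rfl | h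
    · rw [Function.update_of_ne h.ne, dif_pos h, dif_pos (by omega)]
      simp [Fin.snocEquiv, Fin.snoc, h]
    · simp [Fin.snocEquiv, Fin.snoc]
    · rw [Function.update_of_ne h.ne', dif_neg (by omega), dif_neg (by omega)]

end StateSum

/-! ### Ternary digits -/

/-- The digit with number `p` in base `3`. -/
def digit (p x : ℕ) : ℕ := x / 3 ^ p % 3

theorem digit_lt (p x : ℕ) : digit p x < 3 := Nat.mod_lt _ (by norm_num)

/-- Filling a zero digit with `r < 3` causes no carry. -/
theorem digit_add {p x r : ℕ} (h : digit p x = 0) (hr : r < 3) (q : ℕ) :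
    digit q (x + r * 3 ^ p) = if q = p then r else digit q x := by
  unfold digit at *
  rcases lt_trichotomy q p with hq | rfl | hq
  · rw [if_neg hq.ne]
    obtain ⟨k, rfl⟩ := Nat.exists_eq_add_of_lt hq
    rw [show r * 3 ^ (q + k + 1) = 3 ^ q * (3 * (r * 3 ^ k)) by ring,
      Nat.add_mul_div_left _ _ (by positivity), Nat.add_mul_mod_self_left]
  · rw [if_pos rfl, Nat.add_mul_div_right _ _ (by positivity)]
    omega
  · rw [if_neg hq.ne']
    obtain ⟨k, rfl⟩ := Nat.exists_eq_add_of_lt hq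
    rw [show 3 ^ (p + k + 1) = 3 ^ p * 3 * 3 ^ k by ring, ← Nat.div_div_eq_div_mul,
      ← Nat.div_div_eq_div_mul, ← Nat.div_div_eq_div_mul, ← Nat.div_div_eq_div_mul,
      Nat.add_mul_div_right _ _ (by positivity)]
    congr 2
    omega

theorem digit_mul_le (p x : ℕ) : digit p x * 3 ^ p ≤ x :=
  (Nat.mul_le_mul_right _ (Nat.mod_le _ _)).trans (Nat.div_mul_le_self _ _)

/-- Putting the cleared digit back is the situation of `digit_add`, which yields the other digits.
-/
theorem digit_sub (p x q : ℕ) :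
    digit q (x - digit p x * 3 ^ p) = if q = p then 0 else digit q x := by
  have hle := digit_mul_le p x
  have h0 : digit p (x - digit p x * 3 ^ p) = 0 := by
    conv_lhs => unfold digit
    rw [mul_comm, Nat.sub_mul_div]
    omega
  by_cases hq : q = p
  · rw [if_pos hq, hq, h0]
  · have := digit_add h0 (digit_lt p x) q
    rw [Nat.sub_add_cancel hle, if_neg hq] at this
    rw [if_neg hq, this]

/-- A contraction thus reads only inside the current table. -/
theorem add_mul_lt_of_digit {p x r c : ℕ} (h : digit p x = 0) (hr : r < 3) (hp : p < c)
    (hx : x < 3 ^ c) : x + r * 3 ^ p < 3 ^ c := by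
  obtain ⟨k, rfl⟩ := Nat.exists_eq_add_of_lt hp
  have hpos : 0 < 3 ^ p := by positivity
  rw [show 3 ^ (p + k + 1) = 3 ^ k * 3 * 3 ^ p by ring] at *
  rw [← Nat.div_lt_iff_lt_mul hpos] at *
  rw [Nat.add_mul_div_right _ _ hpos]
  unfold digit at h
  omega

/-- An expansion may enlarge the table by the top digit `p = c`; clearing it leads back into the old
table, so no uninitialized cell is read. -/
theorem sub_digit_lt {p x c : ℕ} (hx : x < 3 ^ max c (p + 1)) (hp : p ≤ c) :
    x - digit p x * 3 ^ p < 3 ^ c := by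
  rcases hp.lt_or_eq with hp | rfl
  · rw [max_eq_left (by omega)] at hx
    omega
  · rw [max_eq_right (by omega), pow_succ, mul_comm] at hx
    have hd : digit p x = x / 3 ^ p := Nat.mod_eq_of_lt (Nat.div_lt_of_lt_mul (by linarith))
    have := Nat.mod_lt x (show 0 < 3 ^ p by positivity)
    have := Nat.div_add_mod x (3 ^ p)
    rw [hd, mul_comm]
    omega

/-! ### The interaction of the states and its factorization

The states of a vertex are `0` (left side of the cut), `1` (right side of the cut), `2` (outside
the solution, not dominated) and `3` (outside the solution, domination not required). -/

/-- The factor of the interaction through the states `0`, `1`, `2`. -/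
def spin (s r : ℕ) : ℕ := (if s = r then 1 else 0) + if s = 3 then 1 else 0

/-- The interaction of two adjacent vertices. -/
def bond (s s' : ℕ) : ℕ := ∑ r ∈ range 3, spin s' r * spin s r

theorem spin_le {s r : ℕ} (hr : r < 3) : spin s r ≤ 1 := by
  unfold spin; split_ifs <;> omega

/-- The value `3` occurs for two states `3`. It is odd, so modulo 2 the interaction of states below
`4` is "equal, or one of them is `3`". -/
theorem bond_le (s s' : ℕ) : bond s s' ≤ 3 := by
  refine (sum_le_card_nsmul (range 3) _ 1 fun r hr => ?_).trans (by simp)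
  exact Nat.mul_le_mul (spin_le (mem_range.1 hr)) (spin_le (mem_range.1 hr))

/-- The factor of a slot, which may carry an edge, at the digit `d`. -/
def leg (o : Option (ℕ × ℕ)) (σ : ℕ → ℕ) (d : ℕ) : ℕ :=
  match o with
  | none => if d = 0 then 1 else 0
  | some e => spin (σ e.1) d

theorem leg_none (σ : ℕ → ℕ) (d : ℕ) : leg none σ d = if d = 0 then 1 else 0 := rfl

theorem leg_some (e : ℕ × ℕ) (σ : ℕ → ℕ) (d : ℕ) : leg (some e) σ d = spin (σ e.1) d := rfl

theorem leg_le (o : Option (ℕ × ℕ)) (σ : ℕ → ℕ) {d : ℕ} (hd : d < 3) : leg o σ d ≤ 1 := by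
  cases o with
  | none => simp only [leg]; split_ifs <;> omega
  | some e => exact spin_le hd

/-- The contribution of the states `σ` to the entry `x` of the table with slots `0, …, t - 1`,
after the vertices `0, …, v - 1` and the edges in `D`. -/
def entry (W : ℕ → ℕ → ℕ) (t v : ℕ) (D : Finset (ℕ × ℕ)) (slots : ℕ → Option (ℕ × ℕ))
    (σ : ℕ → ℕ) (x : ℕ) : ℕ :=
  (∏ u ∈ range v, W u (σ u)) * (∏ e ∈ D, bond (σ e.1) (σ e.2)) *
    ∏ p ∈ range t, leg (slots p) σ (digit p x)

section Entry

variable {W : ℕ → ℕ → ℕ} {t v : ℕ} {D : Finset (ℕ × ℕ)} {slots : ℕ → Option (ℕ × ℕ)} {σ : ℕ → ℕ}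

/-- The leg of `e.1` at digit `r`, times the spin of `e.2` at `r`, summed over `r`, is the `bond` of
`e`. The slot becomes free, which pins its digit to `0`; this is why all other digits give zero. -/
theorem entry_contract {p : ℕ} (hp : p < t) {e : ℕ × ℕ} (he : slots p = some e) (heD : e ∉ D)
    (x : ℕ) :
    (if digit p x = 0 then
      ∑ r ∈ range 3, spin (σ e.2) r * entry W t v D slots σ (x + r * 3 ^ p) else 0) =
    entry W t v (insert e D) (Function.update slots p none) σ x := by
  have hp' := mem_range.2 hp
  unfold entry
  rw [prod_insert heD, ← mul_prod_erase _ (fun q => leg (Function.update slots p none q) σ _) hp',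
    Function.update_self, leg_none]
  split_ifs with h
  · have hrest : ∀ r < 3, ∏ q ∈ range t, leg (slots q) σ (digit q (x + r * 3 ^ p)) =
        spin (σ e.1) r * ∏ q ∈ (range t).erase p,
          leg (Function.update slots p none q) σ (digit q x) := by
      intro r hr
      rw [← mul_prod_erase _ _ hp', he, digit_add h hr, if_pos rfl, leg_some]
      congr 1
      refine prod_congr rfl fun q hq => ?_
      rw [digit_add h hr, if_neg (ne_of_mem_erase hq), Function.update_of_ne (ne_of_mem_erase hq)]
    rw [bond, sum_mul, mul_sum, sum_mul]
    refine sum_congr rfl fun r hr => ?_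
    rw [hrest r (mem_range.1 hr)]
    ring
  · simp

/-- A free slot contributes factor `1` at digit `0`, so the old entry with this digit cleared only
lacks the new leg. -/
theorem entry_expand {p : ℕ} (hp : p < t) {e : ℕ × ℕ} (he : slots p = none) (x : ℕ) :
    spin (σ e.1) (digit p x) * entry W t v D slots σ (x - digit p x * 3 ^ p) =
    entry W t v D (Function.update slots p (some e)) σ x := by
  have hp' := mem_range.2 hp
  unfold entry
  rw [← mul_prod_erase _ (fun q => leg (Function.update slots p (some e) q) σ _) hp',
    ← mul_prod_erase _ _ hp', Function.update_self, he, digit_sub, if_pos rfl,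
    leg_none, leg_some, if_pos rfl, one_mul]
  rw [prod_congr (s₁ := (range t).erase p) rfl fun q hq => by
    rw [digit_sub, if_neg (ne_of_mem_erase hq),
      ← Function.update_of_ne (ne_of_mem_erase hq) (some e) slots]]
  ring

/-- By the hypotheses neither contracted edges nor open legs see the state of `v`, so a new vertex
only brings its weight. -/
theorem entry_succ (s : ℕ) (hD : ∀ e ∈ D, e.1 < v ∧ e.2 < v)
    (hs : ∀ p e, slots p = some e → e.1 < v) (x : ℕ) :
    W v s * entry W t v D slots σ x =
      entry W t (v + 1) D slots (Function.update σ v s) x := by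
  unfold entry
  have h1 : ∀ u < v, Function.update σ v s u = σ u := fun u hu => Function.update_of_ne hu.ne _ _
  rw [prod_range_succ, Function.update_self, prod_congr rfl fun u hu => by
      rw [← h1 u (mem_range.1 hu)],
    prod_congr (s₁ := D) rfl fun e he => by rw [← h1 _ (hD e he).1, ← h1 _ (hD e he).2],
    prod_congr (s₁ := range t) rfl fun p _ => show leg (slots p) σ (digit p x) =
      leg (slots p) (Function.update σ v s) (digit p x) by
        cases h : slots p with
        | none => rfl
        | some e => simp only [leg, h1 _ (hs p e h)]]
  ring

theorem entry_le {X : ℕ} (hW : ∀ u s, W u s ≤ X) (x : ℕ) :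
    entry W t v D slots σ x ≤ X ^ v * 3 ^ D.card := by
  unfold entry
  refine (Nat.mul_le_mul (Nat.mul_le_mul ?_ ?_) (prod_le_one' fun p _ =>
    leg_le _ _ (digit_lt _ _))).trans (mul_one _).le
  · simpa using prod_le_pow_card (range v) (fun u => W u (σ u)) X fun u _ => hW _ _
  · exact prod_le_pow_card D _ 3 fun e _ => bond_le _ _

end Entry

/-! ### Edges -/

section Edges

open Classical

variable (adj : ℕ → ℕ → Prop) (n : ℕ)

/-- The edges that have been contracted when the neighbors of `v` before `w` have been treated. -/
noncomputable def doneEdges (v w : ℕ) : Finset (ℕ × ℕ) :=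
  (range n ×ˢ range n).filter fun e =>
    adj e.1 e.2 ∧ e.1 < e.2 ∧ (e.2 < v ∨ e.2 = v ∧ e.1 < w)

/-- The edges that occupy a slot when the neighbors of `v` before `w` have been treated. -/
noncomputable def activeEdges (v w : ℕ) : Finset (ℕ × ℕ) :=
  (range n ×ˢ range n).filter fun e =>
    adj e.1 e.2 ∧ e.1 < e.2 ∧
      (e.1 < v ∧ (v < e.2 ∨ e.2 = v ∧ w ≤ e.1) ∨ e.1 = v ∧ e.2 < w)

theorem doneEdges_succ (v : ℕ) : doneEdges adj n v n = doneEdges adj n (v + 1) 0 := by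
  ext e
  simp only [doneEdges, mem_filter, mem_product, mem_range]
  constructor <;> rintro ⟨h, h', h'', h'''⟩ <;> refine ⟨h, h', h'', ?_⟩ <;> omega

theorem activeEdges_succ (v : ℕ) : activeEdges adj n v n = activeEdges adj n (v + 1) 0 := by
  ext e
  simp only [activeEdges, mem_filter, mem_product, mem_range]
  constructor <;> rintro ⟨h, h', h'', h'''⟩ <;> refine ⟨h, h', h'', ?_⟩ <;> omega

theorem doneEdges_zero : doneEdges adj n 0 0 = ∅ :=
  eq_empty_of_forall_notMem fun e he => by have := (mem_filter.1 he).2.2; omega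

theorem activeEdges_zero : activeEdges adj n 0 0 = ∅ :=
  eq_empty_of_forall_notMem fun e he => by have := (mem_filter.1 he).2.2; omega

theorem activeEdges_last : activeEdges adj n n 0 = ∅ := by
  ext e
  simp only [activeEdges, mem_filter, mem_product, mem_range, notMem_empty, iff_false]
  omega

theorem card_doneEdges_le (v w : ℕ) : (doneEdges adj n v w).card ≤ n * n :=
  (card_filter_le _ _).trans (by simp)

variable {adj n}

theorem doneEdges_insert {v w : ℕ} (hv : v < n) (hw : w < v) (h : adj w v) :
    insert (w, v) (doneEdges adj n v w) = doneEdges adj n v (w + 1) := by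
  ext ⟨a, b⟩
  simp only [doneEdges, mem_filter, mem_product, mem_range, mem_insert, Prod.mk.injEq]
  constructor
  · rintro (⟨rfl, rfl⟩ | h)
    · exact ⟨⟨by omega, by omega⟩, h, by omega⟩
    · exact ⟨h.1, h.2.1, by omega⟩
  · rintro ⟨h1, h2, h3⟩
    by_cases h : a = w ∧ b = v
    · exact .inl h
    · exact .inr ⟨h1, h2, by omega⟩

theorem doneEdges_of_lt {v w : ℕ} (hw : v ≤ w ∨ ¬ adj w v) :
    doneEdges adj n v w = doneEdges adj n v (w + 1) := by
  ext ⟨a, b⟩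
  simp only [doneEdges, mem_filter, mem_product, mem_range]
  constructor
  · rintro ⟨h1, h2, h3⟩; exact ⟨h1, h2, by omega⟩
  · rintro ⟨h1, h2, h3⟩
    refine ⟨h1, h2, h3.1, ?_⟩
    rcases h3 with ⟨h4, h5 | ⟨rfl, h5⟩⟩
    · exact .inl h5
    · rcases Nat.lt_succ_iff_lt_or_eq.1 h5 with h5 | rfl
      · exact .inr ⟨rfl, h5⟩
      · rcases hw with hw | hw
        · omega
        · exact absurd h2 hw

theorem mem_activeEdges_contract {v w : ℕ} (hw : w < v) (e : ℕ × ℕ) :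
    e ∈ activeEdges adj n v (w + 1) ↔ e ∈ activeEdges adj n v w ∧ e ≠ (w, v) := by
  obtain ⟨a, b⟩ := e
  simp only [activeEdges, mem_filter, mem_product, mem_range, ne_eq, Prod.mk.injEq]
  constructor
  · rintro ⟨h1, h2, h3⟩; exact ⟨⟨h1, h2, by omega⟩, by omega⟩
  · rintro ⟨⟨h1, h2, h3⟩, h4⟩; exact ⟨h1, h2, by omega⟩

theorem mem_activeEdges_expand {v w : ℕ} (hw : v < w) (hwn : w < n) (h : adj v w) (e : ℕ × ℕ) :
    e ∈ activeEdges adj n v (w + 1) ↔ e ∈ activeEdges adj n v w ∨ e = (v, w) := by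
  obtain ⟨a, b⟩ := e
  simp only [activeEdges, mem_filter, mem_product, mem_range, Prod.mk.injEq]
  constructor
  · rintro ⟨h1, h2, h3⟩
    by_cases h : a = v ∧ b = w
    · exact .inr h
    · exact .inl ⟨h1, h2, by omega⟩
  · rintro (⟨h1, h2, h3⟩ | ⟨rfl, rfl⟩)
    · exact ⟨h1, h2, by omega⟩
    · exact ⟨⟨by omega, hwn⟩, h, by omega⟩

theorem activeEdges_of_not_adj {v w : ℕ} (h : ¬ adj v w) (h' : ¬ adj w v) :
    activeEdges adj n v (w + 1) = activeEdges adj n v w := by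
  ext ⟨a, b⟩
  simp only [activeEdges, mem_filter, mem_product, mem_range]
  constructor
  · rintro ⟨h1, h2, h3⟩
    have : ¬ (a = v ∧ b = w) := by rintro ⟨rfl, rfl⟩; exact h h2
    exact ⟨h1, h2, by omega⟩
  · rintro ⟨h1, h2, h3⟩
    have : ¬ (a = w ∧ b = v) := by rintro ⟨rfl, rfl⟩; exact h' h2
    exact ⟨h1, h2, by omega⟩

/-- Once `w` exceeds `v`, all edges from earlier vertices to `v` have been released. What is active
then crosses the cut after `v`, and `(v, w)` is a further edge of that cut, so a new slot still fits
into the cutwidth. -/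
theorem card_activeEdges_lt {v w : ℕ} (hw : v < w) (hwn : w < n) (h : adj v w) :
    (activeEdges adj n v w).card < (activeEdges adj n (v + 1) 0).card := by
  refine card_lt_card ((ssubset_iff_of_subset ?_).2 ⟨(v, w), ?_, ?_⟩)
  · rintro ⟨a, b⟩
    simp only [activeEdges, mem_filter, mem_product, mem_range]
    rintro ⟨h1, h2, h3⟩; exact ⟨h1, h2, by omega⟩
  · simp only [activeEdges, mem_filter, mem_product, mem_range]
    exact ⟨⟨by omega, hwn⟩, h, by omega⟩
  · simp [activeEdges]

end Edges

/-! ### The program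

Variables and arrays: `10` base `β`, `11` the power `β ^ (n * n)`, `12`, `13` counters, `14` random
bit, `15` accumulator, `16` vertex weights, `17` the root, `18` table between vertices, `19` number
of table entries, `20` current vertex, `21` table counter, `22` table during a vertex (four entries
for each entry of `18`), `23` current neighbor, `24` slots of edges, `25` occupied slots, `26`
current slot, `27` scratch table, `28` extraction of digits, `29` counter.
A slot with number `p` is represented by `3 ^ p`. -/

instance : Add Expr := ⟨.op .add⟩
instance : Sub Expr := ⟨.op .sub⟩
instance : Mul Expr := ⟨.op .mul⟩
instance : Div Expr := ⟨.op .div⟩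
instance : Mod Expr := ⟨.op .mod⟩

section Val

variable (m : Memory) (e e' : Expr) (a c : ℕ)

@[simp] theorem Expr.val_add : (e + e').val m = e.val m + e'.val m := rfl
@[simp] theorem Expr.val_sub : (e - e').val m = e.val m - e'.val m := rfl
@[simp] theorem Expr.val_mul : (e * e').val m = e.val m * e'.val m := rfl
@[simp] theorem Expr.val_div : (e / e').val m = e.val m / e'.val m := rfl
@[simp] theorem Expr.val_mod : (e % e').val m = e.val m % e'.val m := rfl
@[simp] theorem Expr.val_lit : (Expr.lit c).val m = c := rfl
@[simp] theorem Expr.val_read : (Expr.read a e).val m = m a (e.val m) := rfl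
@[simp] theorem Expr.val_eq :
    (Expr.op .eq e e').val m = if e.val m = e'.val m then 1 else 0 := rfl
@[simp] theorem Expr.val_lt :
    (Expr.op .lt e e').val m = if e.val m < e'.val m then 1 else 0 := rfl

end Val

/-- The number of vertices. -/
def Expr.order : Expr := .read 0 (.lit 0)

/-- The entry of the adjacency matrix for the vertices at the positions `20` and `23`. -/
def Expr.adjacent : Expr :=
  .read 1 (.read 2 (.var 20) * .order + .read 2 (.var 23))

/-- The digit of the table index for the current slot. -/
def Expr.digit : Expr := .var 21 / .lit 4 / .var 26 % .lit 3

/-- The state of the current vertex. -/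
def Expr.state : Expr := .var 21 % .lit 4

/-- The factor `spin` of the current vertex. -/
def Expr.spin (r : Expr) : Expr := .op .eq .state r + .op .eq .state (.lit 3)

/-- The new table entry if the edge in the current slot ends at the current vertex. -/
def Expr.contract : Expr :=
  .op .eq .digit (.lit 0) * (.spin (.lit 0) * .read 22 (.var 21) +
    .spin (.lit 1) * .read 22 (.var 21 + .lit 4 * .var 26) +
    .spin (.lit 2) * .read 22 (.var 21 + .lit 8 * .var 26))

/-- The new table entry if the edge in the current slot starts at the current vertex. -/
def Expr.expand : Expr :=
  .spin .digit * .read 22 (.var 21 - .lit 4 * (.digit * .var 26))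

/-- The weight of the current vertex in its current state. -/
def Expr.weightOf : Expr :=
  (.lit 1 - .op .eq (.var 20) (.var 17) * (.lit 1 - .op .eq .state (.lit 0))) *
    (.op .lt .state (.lit 2) * .read 16 (.var 20) + (.lit 1 - .op .lt .state (.lit 2)))

/-- Replacing all table entries. -/
def Prog.pass (e : Expr) : Prog :=
  .seq (.loop 21 (.lit 4 * .var 19) (.write 27 (.var 21) e))
    (.loop 21 (.lit 4 * .var 19) (.write 22 (.var 21) (.read 27 (.var 21))))

/-- Treating an edge that ends at the current vertex. -/
def Prog.contract : Prog :=
  .seq (.assign 26 (.read 24 (.var 23 * .order + .var 20)))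
    (.seq (.write 25 (.var 26) (.lit 0)) (.pass .contract))

/-- Searching for a free slot. -/
def Prog.findSlot : Prog :=
  .seq (.assign 26 (.lit 1)) (.while (.read 25 (.var 26)) (.assign 26 (.var 26 * .lit 3)))

/-- Treating an edge that starts at the current vertex. -/
def Prog.expand : Prog :=
  .seq .findSlot
    (.seq (.write 25 (.var 26) (.lit 1))
      (.seq (.write 24 (.var 20 * .order + .var 23) (.var 26))
        (.seq (.ite (.op .eq (.var 26) (.var 19)) (.assign 19 (.var 19 * .lit 3)) .skip)
          (.pass .expand))))

/-- Treating a pair of vertices. -/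
def Prog.neighbor : Prog :=
  .ite .adjacent (.ite (.op .lt (.var 23) (.var 20)) .contract .expand) .skip

/-- Treating a vertex. -/
def Prog.vertex : Prog :=
  .seq (.loop 21 (.lit 4 * .var 19)
      (.write 22 (.var 21) (.weightOf * .read 18 (.var 21 / .lit 4))))
    (.seq (.loop 23 .order .neighbor)
      (.loop 21 (.var 19) (.write 18 (.var 21)
        (.read 22 (.lit 4 * .var 21) + .read 22 (.lit 4 * .var 21 + .lit 1) +
          .read 22 (.lit 4 * .var 21 + .lit 2) + .read 22 (.lit 4 * .var 21 + .lit 3)))))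

/-- The dynamic program for a fixed root. -/
def Prog.table : Prog :=
  .seq (.write 18 (.lit 0) (.lit 1)) (.seq (.assign 19 (.lit 1)) (.loop 20 .order .vertex))

/-! ### Correctness of the dynamic program -/

/-- The numerical assumptions on the input under which the dynamic program is analyzed. -/
structure Setting (b n t X : ℕ) (adj : ℕ → ℕ → Prop) (W : ℕ → ℕ → ℕ) : Prop where
  symm : ∀ u w, adj u w → adj w u
  irrefl : ∀ u, ¬ adj u u
  cut : ∀ v < n, (activeEdges adj n (v + 1) 0).card ≤ t
  weight_le : ∀ u s, W u s ≤ X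
  size_lt : 12 * 3 ^ t < 2 ^ b
  order_lt : n < 2 ^ b
  value_lt : ∀ v ≤ n, 4 ^ v * (X ^ v * 3 ^ (n * n)) < 2 ^ b

/-- The memory represents the graph. -/
structure Represents (n : ℕ) (adj : ℕ → ℕ → Prop) (m : Memory) : Prop where
  order : m 0 0 = n
  adj : ∀ u < n, ∀ w < n, (m 1 (m 2 u * n + m 2 w) ≠ 0 ↔ adj u w)

/-- The memory represents the assignment of slots to edges. -/
structure Slotted (adj : ℕ → ℕ → Prop) (n t v w : ℕ) (m : Memory)
    (slots : ℕ → Option (ℕ × ℕ)) (c : ℕ) : Prop where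
  size : m 19 0 = 3 ^ c
  le : c ≤ t
  lt : ∀ p e, slots p = some e → p < c
  mem : ∀ p e, slots p = some e → e ∈ activeEdges adj n v w ∧ m 24 (e.1 * n + e.2) = 3 ^ p
  ex : ∀ e ∈ activeEdges adj n v w, ∃ p, slots p = some e
  used : ∀ p, m 25 (3 ^ p) ≠ 0 ↔ slots p ≠ none

/-- The table during the treatment of vertex `v`, before its neighbor `w`. -/
def InnerTable (adj : ℕ → ℕ → Prop) (W : ℕ → ℕ → ℕ) (n t v w : ℕ) (m : Memory) : Prop :=
  ∃ slots c, Slotted adj n t v w m slots c ∧ ∀ j < 4 * 3 ^ c, m 22 j =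
    stateSum v fun σ =>
      entry W t (v + 1) (doneEdges adj n v w) slots (Function.update σ v (j % 4)) (j / 4)

/-- The table before the treatment of vertex `v`. -/
def OuterTable (adj : ℕ → ℕ → Prop) (W : ℕ → ℕ → ℕ) (n t v : ℕ) (m : Memory) : Prop :=
  ∃ slots c, Slotted adj n t v 0 m slots c ∧ ∀ x < 3 ^ c, m 18 x =
    stateSum v fun σ => entry W t v (doneEdges adj n v 0) slots σ x

theorem Slotted.congr {adj : ℕ → ℕ → Prop} {n t v w : ℕ} {m m' : Memory}
    {slots : ℕ → Option (ℕ × ℕ)} {c : ℕ} (h : Slotted adj n t v w m slots c)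
    (h19 : m' 19 = m 19) (h24 : m' 24 = m 24) (h25 : m' 25 = m 25) :
    Slotted adj n t v w m' slots c :=
  ⟨by rw [h19, h.size], h.le, h.lt, by rw [h24]; exact h.mem, h.ex, by rw [h25]; exact h.used⟩

section

variable {ω : ℕ → Bool} {b n t X : ℕ} {adj : ℕ → ℕ → Prop} {W : ℕ → ℕ → ℕ}

theorem Setting.one_le (S : Setting b n t X adj W) : 1 ≤ b := by
  by_contra h
  have := S.size_lt
  rw [show b = 0 by omega] at this
  have : 0 < 3 ^ t := by positivity
  omega

theorem Setting.pow_lt (S : Setting b n t X adj W) {c : ℕ} (hc : c ≤ t) :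
    4 * 3 ^ c < 2 ^ b := by
  have := S.size_lt
  have := Nat.pow_le_pow_right (show 0 < 3 by norm_num) hc
  omega

theorem Setting.entry_lt (S : Setting b n t X adj W) {k v w v' : ℕ} (hk : k ≤ v') (hv : v' ≤ n)
    (slots : ℕ → Option (ℕ × ℕ)) (g : (ℕ → ℕ) → ℕ → ℕ) (x : ℕ) :
    stateSum k (fun σ => entry W t v' (doneEdges adj n v w) slots (g σ) x) < 2 ^ b := by
  refine lt_of_le_of_lt (stateSum_le fun σ => (entry_le S.weight_le x).trans
    (Nat.mul_le_mul_left _ (Nat.pow_le_pow_right (by norm_num) (card_doneEdges_le adj n v w))))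
    (lt_of_le_of_lt ?_ (S.value_lt v' hv))
  exact Nat.mul_le_mul_right _ (Nat.pow_le_pow_right (by norm_num) hk)

/-- New entries depend on old entries at other indices, hence the detour through the scratch table
`27`. The factor `24` is two loops, four states, three units per iteration. -/
theorem Wp.pass {e : Expr} {s : Config} {c : ℕ} (S : Setting b n t X adj W) (hc : c ≤ t)
    (he' : e.charge + e.weight ≤ 990) (h19 : s.mem 19 0 = 3 ^ c) (f : ℕ → ℕ)
    (hf : ∀ j < 4 * 3 ^ c, f j < 2 ^ b)
    (he : ∀ j < 4 * 3 ^ c, ∀ s' : Config, (∀ x, x ≠ 21 → x ≠ 27 → s'.mem x = s.mem x) →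
      s'.mem 21 0 = j → e.val s'.mem = f j) :
    Wp ω b (.pass e) s (24 * 3 ^ t + 4) (fun s' => ∀ j < 4 * 3 ^ c, s'.mem 22 j = f j) := by
  have hb := S.one_le
  have hM := S.pow_lt hc
  have hle := Nat.pow_le_pow_right (show 0 < 3 by norm_num) hc
  refine (Wp.seq (Wp.fill (by decide) f _ hb (by decide) he' hM ?_ hf he) ?_).weaken
    (N := (4 * 3 ^ c * 3 + 2) + (4 * 3 ^ c * 3 + 2)) (by omega) fun s' _ h => h
  · intro s' h; simp [h 19, h19]
  · rintro s₁ hfr ⟨-, hs₁⟩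
    have h19' : s₁.mem 19 0 = 3 ^ c := by rw [hfr 19 (by simp [Prog.touches, Prog.loop, Prog.assign]), h19]
    refine (Wp.fill (by decide) f _ hb (by decide) (by decide) hM ?_ hf ?_).weaken le_rfl
      fun s' _ h => h.2
    · intro s' h; simp [h 19, h19']
    · intro j hj s' h h21; simp [h 27, h21, hs₁ j hj]

theorem Slotted.contract {v w c p : ℕ} {m m' : Memory} {slots : ℕ → Option (ℕ × ℕ)}
    (h : Slotted adj n t v w m slots c) (hw : w < v) (hp : slots p = some (w, v))
    (h19 : m' 19 = m 19) (h24 : m' 24 = m 24)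
    (h25 : ∀ i, m' 25 i = if i = 3 ^ p then 0 else m 25 i) :
    Slotted adj n t v (w + 1) m' (Function.update slots p none) c := by
  have hinj : Function.Injective fun q : ℕ => 3 ^ q := Nat.pow_right_injective (by norm_num)
  have hne : ∀ q e, Function.update slots p none q = some e → q ≠ p ∧ slots q = some e := by
    intro q e hq
    by_cases hqp : q = p
    · subst hqp; simp at hq
    · exact ⟨hqp, by rwa [Function.update_of_ne hqp] at hq⟩
  refine ⟨by rw [h19, h.size], h.le, fun q e hq => h.lt q e (hne q e hq).2, ?_, ?_, ?_⟩
  · intro q e hq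
    obtain ⟨hqp, hq⟩ := hne q e hq
    obtain ⟨h₁, h₂⟩ := h.mem q e hq
    refine ⟨(mem_activeEdges_contract hw e).2 ⟨h₁, ?_⟩, by rw [h24, h₂]⟩
    -- Array `24` records only one slot per edge, so no other slot can hold the contracted edge.
    rintro rfl
    exact hqp (hinj (h₂.symm.trans (h.mem p _ hp).2))
  · intro e he
    obtain ⟨h₁, h₂⟩ := (mem_activeEdges_contract hw e).1 he
    obtain ⟨q, hq⟩ := h.ex e h₁
    refine ⟨q, ?_⟩
    rwa [Function.update_of_ne]
    rintro rfl
    rw [hp] at hq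
    exact h₂ (Option.some.inj hq).symm
  · intro q
    rw [h25]
    by_cases hqp : q = p
    · subst hqp; simp
    · rw [if_neg fun h' => hqp (hinj h'), Function.update_of_ne hqp, h.used]

theorem Wp.contract {s : Config} {v w : ℕ} (S : Setting b n t X adj W)
    (hR : Represents n adj s.mem) (h20 : s.mem 20 0 = v) (h23 : s.mem 23 0 = w) (hw : w < v)
    (hv : v < n) (hadj : adj w v) (hI : InnerTable adj W n t v w s.mem) :
    Wp ω b .contract s (24 * 3 ^ t + 6)
      (fun s' => InnerTable adj W n t v (w + 1) s'.mem) := by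
  have hb := S.one_le
  obtain ⟨slots, c, hS, hT⟩ := hI
  obtain ⟨p, hp⟩ := hS.ex (w, v) (by simp [activeEdges, hadj, hw, hv, hw.trans hv])
  have hpc := hS.lt p _ hp
  have hslot := (hS.mem p _ hp).2
  have hplt : 3 ^ p < 2 ^ b := by
    have := Nat.pow_le_pow_right (show 0 < 3 by norm_num) (hpc.le.trans hS.le)
    have := S.size_lt
    omega
  set f : ℕ → ℕ := fun j => stateSum v fun σ => entry W t (v + 1) (doneEdges adj n v (w + 1))
    (Function.update slots p none) (Function.update σ v (j % 4)) (j / 4) with hf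
  -- Index `j = 4 * x + s` holds entry `x` for state `s` of `v`; adding `r` to digit `p` of `x`
  -- therefore shifts `j` by `4 * (r * 3 ^ p)`.
  have hfval : ∀ j < 4 * 3 ^ c, f j = if digit p (j / 4) = 0 then
      ∑ r ∈ range 3, spin (j % 4) r * s.mem 22 (j + 4 * (r * 3 ^ p)) else 0 := by
    intro j hj
    have hx : j / 4 < 3 ^ c := by omega
    have key : ∀ σ : ℕ → ℕ, entry W t (v + 1) (doneEdges adj n v (w + 1))
        (Function.update slots p none) (Function.update σ v (j % 4)) (j / 4) =
        if digit p (j / 4) = 0 then ∑ r ∈ range 3, spin (j % 4) r *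
          entry W t (v + 1) (doneEdges adj n v w) slots (Function.update σ v (j % 4))
            (j / 4 + r * 3 ^ p) else 0 := by
      intro σ
      rw [← doneEdges_insert hv hw hadj, ← entry_contract (hpc.trans_le hS.le) hp
        (by simp [doneEdges])]
      simp
    simp only [hf, key]
    split_ifs with hd
    · rw [← stateSum_sum]
      refine sum_congr rfl fun r hr => ?_
      have := add_mul_lt_of_digit hd (mem_range.1 hr) hpc hx
      rw [hT _ (by omega), stateSum_mul, show (j + 4 * (r * 3 ^ p)) % 4 = j % 4 by omega,
        show (j + 4 * (r * 3 ^ p)) / 4 = j / 4 + r * 3 ^ p by omega]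
    · exact stateSum_zero v
  refine (Wp.seq (N := 1) (R := fun s' => s'.mem = s.mem.set 26 0 (3 ^ p))
    (Wp.assign hb (by decide) ?_ ?_) ?_).weaken (N := 1 + (1 + (24 * 3 ^ t + 4)))
    (by omega) fun _ _ h => h
  · simpa [Expr.order, hR.order, h20, h23, hslot] using hplt
  · simp [Expr.order, hR.order, h20, h23, hslot]
  rintro s₁ - h₁
  refine Wp.seq (R := fun s' => s'.mem = (s.mem.set 26 0 (3 ^ p)).set 25 (3 ^ p) 0)
    (Wp.write hb (by decide) (by simp) (by simp [h₁])) ?_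
  rintro s₂ - h₂
  refine (Wp.pass S hS.le (by decide) (by simp [h₂, hS.size]) f
    (fun j _ => S.entry_lt (by omega) hv _ _ _) ?_).weaken le_rfl ?_
  · intro j hj s' hfr h21
    have h26 : s'.mem 26 0 = 3 ^ p := by rw [hfr 26 (by decide) (by decide), h₂]; simp
    have h22 : s'.mem 22 = s.mem 22 := by rw [hfr 22 (by decide) (by decide), h₂]; simp
    rw [hfval j hj]
    simp only [Expr.contract, Expr.spin, Expr.digit, Expr.state, Expr.val_add, Expr.val_mul,
      Expr.val_div, Expr.val_mod, Expr.val_lit, Expr.val_read, Expr.val_eq, Expr.val_var, h21, h26,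
      h22, sum_range_succ, range_zero, sum_empty, spin, digit]
    split_ifs <;> simp [← mul_assoc]
  · intro s₃ hfr h₃
    refine ⟨_, c, hS.contract hw hp ?_ ?_ ?_, h₃⟩
    · rw [hfr 19 (by decide), h₂]; simp
    · rw [hfr 24 (by decide), h₂]; simp
    · intro i; rw [hfr 25 (by decide), h₂]; simp

end

/-! ### Occupying slots, and the passage over a whole vertex -/

theorem mul_add_inj {n a b v w : ℕ} (hb : b < n) (hw : w < n) (h : a * n + b = v * n + w) :
    a = v ∧ b = w := by
  have hn : 0 < n := by omega
  have h₁ := congrArg (· / n) h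
  have h₂ := congrArg (· % n) h
  simp only [mul_comm _ n, Nat.mul_add_div hn, Nat.div_eq_of_lt hb, Nat.div_eq_of_lt hw,
    Nat.mul_add_mod, Nat.mod_eq_of_lt hb, Nat.mod_eq_of_lt hw] at h₁ h₂
  exact ⟨by omega, h₂⟩

section

variable {ω : ℕ → Bool} {b n t X : ℕ} {adj : ℕ → ℕ → Prop} {W : ℕ → ℕ → ℕ}

/-- Occupied slots hold distinct active edges, since array `24` stores one slot per edge. Applied to
the first free slot, this bounds its number. -/
theorem Slotted.le_card {v w c p : ℕ} {m : Memory} {slots : ℕ → Option (ℕ × ℕ)}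
    (h : Slotted adj n t v w m slots c) (hp : ∀ q < p, slots q ≠ none) :
    p ≤ (activeEdges adj n v w).card := by
  have hinj : Function.Injective fun q : ℕ => 3 ^ q := Nat.pow_right_injective (by norm_num)
  have hsome : ∀ q < p, slots q = some ((slots q).getD (0, 0)) := fun q hq => by
    obtain ⟨e, he⟩ := Option.ne_none_iff_exists'.1 (hp q hq)
    simp [he]
  have := card_le_card_of_injOn (s := range p) (t := activeEdges adj n v w)
    (fun q => (slots q).getD (0, 0))
    (fun q hq => (h.mem q _ (hsome q (by simpa using hq))).1) (by
      intro q hq q' hq' heq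
      have h₁ := (h.mem q _ (hsome q (by simpa using hq))).2
      have h₂ := (h.mem q' _ (hsome q' (by simpa using hq'))).2
      simp only at heq
      rw [heq] at h₁
      exact hinj (h₁.symm.trans h₂))
  simpa using this

theorem Slotted.expand {v w c p : ℕ} {m m' : Memory} {slots : ℕ → Option (ℕ × ℕ)}
    (h : Slotted adj n t v w m slots c) (hw : v < w) (hwn : w < n) (hadj : adj v w)
    (hc : max c (p + 1) ≤ t) (hp : slots p = none) (h19 : m' 19 0 = 3 ^ max c (p + 1))
    (h24 : ∀ i, m' 24 i = if i = v * n + w then 3 ^ p else m 24 i)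
    (h25 : ∀ i, m' 25 i = if i = 3 ^ p then 1 else m 25 i) :
    Slotted adj n t v (w + 1) m' (Function.update slots p (some (v, w))) (max c (p + 1)) := by
  have hinj : Function.Injective fun q : ℕ => 3 ^ q := Nat.pow_right_injective (by norm_num)
  have hcases : ∀ q e, Function.update slots p (some (v, w)) q = some e →
      q = p ∧ e = (v, w) ∨ q ≠ p ∧ slots q = some e := by
    intro q e hq
    by_cases hqp : q = p
    · subst hqp
      rw [Function.update_self] at hq
      exact .inl ⟨rfl, (Option.some.inj hq).symm⟩
    · exact .inr ⟨hqp, by rwa [Function.update_of_ne hqp] at hq⟩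
  refine ⟨h19, hc, ?_, ?_, ?_, ?_⟩
  · intro q e hq
    rcases hcases q e hq with ⟨rfl, -⟩ | ⟨-, hq⟩
    · omega
    · have := h.lt q e hq; omega
  · intro q e hq
    rcases hcases q e hq with ⟨rfl, rfl⟩ | ⟨-, hq⟩
    · exact ⟨(mem_activeEdges_expand hw hwn hadj _).2 (.inr rfl), by simp [h24]⟩
    · obtain ⟨h₁, h₂⟩ := h.mem q e hq
      refine ⟨(mem_activeEdges_expand hw hwn hadj _).2 (.inl h₁), ?_⟩
      rw [h24, if_neg, h₂]
      -- The cell written belongs to `(v, w)` alone, and `(v, w)` was not active before.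
      intro heq
      simp only [activeEdges, mem_filter, mem_product, mem_range] at h₁
      have := mul_add_inj h₁.1.2 hwn heq
      omega
  · intro e he
    rcases (mem_activeEdges_expand hw hwn hadj _).1 he with he | rfl
    · obtain ⟨q, hq⟩ := h.ex e he
      refine ⟨q, ?_⟩
      rwa [Function.update_of_ne]
      rintro rfl
      simp [hp] at hq
    · exact ⟨p, by simp⟩
  · intro q
    rw [h25]
    by_cases hqp : q = p
    · subst hqp; simp
    · rw [if_neg fun h' => hqp (hinj h'), Function.update_of_ne hqp, h.used]

theorem Wp.findSlot {s : Config} {v w c : ℕ} {slots : ℕ → Option (ℕ × ℕ)}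
    (S : Setting b n t X adj W) (hS : Slotted adj n t v w s.mem slots c) :
    Wp ω b .findSlot s (2 * t + 2) (fun s' => ∃ p, slots p = none ∧ p ≤ c ∧
      p ≤ (activeEdges adj n v w).card ∧ s'.mem 26 0 = 3 ^ p) := by
  have hb := S.one_le
  have hcond : ∀ i, ∀ s' : Config, s'.mem 25 = s.mem 25 → s'.mem 26 0 = 3 ^ i →
      ((Expr.read 25 (.var 26)).val s'.mem ≠ 0 ↔ slots i ≠ none) := by
    intro i s' h25 h26
    simpa [h25, h26] using hS.used i
  refine (Wp.seq (N := 1) (R := fun s' => s'.mem 26 0 = 1)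
    (Wp.assign hb (by decide) ?_ (by simp)) fun s₁ hfr₁ h₁ =>
    Wp.while (N := 1) (M := t) (fun i s' => s'.mem 26 0 = 3 ^ i ∧ ∀ q < i, slots q ≠ none) hb
      (by decide) (by simpa using h₁) ?_ ?_).weaken (by omega) fun _ _ h => h
  · simpa using Nat.one_lt_two_pow (by omega)
  · rintro i s' hfr ⟨h26, hq⟩ hv
    have h25 : s'.mem 25 = s.mem 25 := by rw [hfr 25 (by decide), hfr₁ 25 (by decide)]
    have hi := (hcond i s' h25 h26).1 hv
    obtain ⟨e, he⟩ := Option.ne_none_iff_exists'.1 hi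
    have hic := hS.lt i e he
    have hval : (Expr.var 26 * .lit 3).val s'.mem = 3 ^ (i + 1) := by simp [h26, pow_succ]
    refine ⟨hic.trans_le hS.le, Wp.assign hb (by decide) ?_ ?_⟩
    · rw [hval]
      have := Nat.pow_le_pow_right (show 0 < 3 by norm_num) (hic.trans_le hS.le)
      have := S.size_lt
      omega
    · rw [hval]
      refine ⟨by simp, fun q hq' => ?_⟩
      rcases Nat.lt_succ_iff_lt_or_eq.1 hq' with h | rfl
      · exact hq q h
      · exact hi
  · rintro i s' hfr ⟨h26, hq⟩ hv
    have h25 : s'.mem 25 = s.mem 25 := by rw [hfr 25 (by decide), hfr₁ 25 (by decide)]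
    have hi : slots i = none := by
      by_contra h
      exact (hcond i s' h25 h26).2 h hv
    refine ⟨i, hi, ?_, hS.le_card hq, h26⟩
    -- Slot `c` is free because occupied slots lie below `c`, so the search stops there at the
    -- latest.
    by_contra hlt
    obtain ⟨e, he⟩ := Option.ne_none_iff_exists'.1 (hq c (by omega))
    exact lt_irrefl _ (hS.lt c e he)

theorem Wp.expand {s : Config} {v w : ℕ} (S : Setting b n t X adj W)
    (hR : Represents n adj s.mem) (h20 : s.mem 20 0 = v) (h23 : s.mem 23 0 = w) (hw : v < w)
    (hwn : w < n) (hadj : adj v w) (hI : InnerTable adj W n t v w s.mem) :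
    Wp ω b .expand s (24 * 3 ^ t + 2 * t + 10)
      (fun s' => InnerTable adj W n t v (w + 1) s'.mem) := by
  have hb := S.one_le
  obtain ⟨slots, c, hS, hT⟩ := hI
  refine (Wp.seq (Wp.findSlot S hS) (N' := 1 + (1 + ((1 + 1) + (24 * 3 ^ t + 4)))) ?_).weaken
    (by omega) fun _ _ h => h
  rintro s₁ hfr₁ ⟨p, hp, hpc, hcard, h26⟩
  -- The slots below `p` are filled by active edges, which are strictly fewer than the edges of the
  -- cut after `v`.
  have hct : max c (p + 1) ≤ t := by
    have := card_activeEdges_lt hw hwn hadj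
    have := S.cut v (by omega)
    have := hS.le
    omega
  have hsmall : 3 ^ p < 2 ^ b ∧ 3 ^ c * 3 < 2 ^ b := by
    have h₁ := Nat.pow_le_pow_right (show 0 < 3 by norm_num) ((le_max_right c (p + 1)).trans hct)
    have h₂ := Nat.pow_le_pow_right (show 0 < 3 by norm_num) hS.le
    have := S.size_lt
    rw [pow_succ] at h₁
    omega
  have hmem : ∀ a, a ≠ 26 → s₁.mem a = s.mem a := fun a ha =>
    hfr₁ a (by simpa [Prog.touches, Prog.findSlot, Prog.assign] using ha)
  refine Wp.seq (R := fun s' => s'.mem = s₁.mem.set 25 (3 ^ p) 1)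
    (Wp.write hb (by decide) ?_ (by simp [h26])) ?_
  · simpa using Nat.one_lt_two_pow (by omega)
  rintro s₂ - h₂
  refine Wp.seq (R := fun s' => s'.mem = (s₁.mem.set 25 (3 ^ p) 1).set 24 (v * n + w) (3 ^ p))
    (Wp.write hb (by decide) ?_ ?_) ?_
  · simpa [h₂, h26] using hsmall.1
  · simp [h₂, h26, Expr.order, hmem, h20, h23, hR.order]
  rintro s₃ - h₃
  have h19 : s₃.mem 19 0 = 3 ^ c := by rw [h₃]; simp [hmem, hS.size]
  have h26' : s₃.mem 26 0 = 3 ^ p := by rw [h₃]; simp [h26]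
  -- The program compares `3 ^ p` with `3 ^ c`. As `p ≤ c`, equality is the only case in which the
  -- table grows.
  refine Wp.seq (R := fun s' => s'.mem 19 0 = 3 ^ max c (p + 1)) ?_ ?_
  · refine Wp.ite hb (by decide) ?_ ?_
    · intro hv
      have heq : p = c := by
        by_contra hne
        have : (3 : ℕ) ^ p ≠ 3 ^ c := fun h => hne (Nat.pow_right_injective (le_refl 2 |>.trans
          (by norm_num)) h)
        simp [h19, h26', this] at hv
      refine Wp.assign hb (by decide) ?_ ?_
      · simpa [h19] using hsmall.2
      · simp [h19, heq, pow_succ]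
    · intro hv
      refine Wp.skip hb ?_
      have hne : p ≠ c := by
        rintro rfl
        simp [h19, h26'] at hv
      rw [h19, max_eq_left (by omega)]
  rintro s₄ hfr₄ h₄
  have hmem₄ : ∀ a, a ≠ 19 → a ≠ 24 → a ≠ 25 → a ≠ 26 → s₄.mem a = s.mem a := by
    intro a h₁ h₂ h₅ h₆
    rw [hfr₄ a (by simpa [Prog.touches, Prog.assign] using h₁), h₃]
    simp [h₂, h₅, hmem a h₆]
  have h26₄ : s₄.mem 26 0 = 3 ^ p := by rw [hfr₄ 26 (by decide), h26']
  set f : ℕ → ℕ := fun j => stateSum v fun σ => entry W t (v + 1) (doneEdges adj n v (w + 1))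
    (Function.update slots p (some (v, w))) (Function.update σ v (j % 4)) (j / 4) with hf
  have hfval : ∀ j < 4 * 3 ^ max c (p + 1), f j =
      spin (j % 4) (digit p (j / 4)) * s.mem 22 (j - 4 * (digit p (j / 4) * 3 ^ p)) := by
    intro j hj
    have := sub_digit_lt (p := p) (x := j / 4) (by omega) hpc
    have hle := digit_mul_le p (j / 4)
    rw [hT _ (by omega), stateSum_mul,
      show (j - 4 * (digit p (j / 4) * 3 ^ p)) % 4 = j % 4 by omega,
      show (j - 4 * (digit p (j / 4) * 3 ^ p)) / 4 = j / 4 - digit p (j / 4) * 3 ^ p by omega,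
      doneEdges_of_lt (.inl hw.le)]
    simp only [hf]
    congr 1
    funext σ
    rw [← entry_expand (by omega) hp]
    simp
  refine (Wp.pass S hct (by decide) h₄ f (fun j _ => S.entry_lt (by omega) (by omega) _ _ _)
    ?_).weaken le_rfl ?_
  · intro j hj s' hfr h21
    have h26 : s'.mem 26 0 = 3 ^ p := by rw [hfr 26 (by decide) (by decide), h26₄]
    have h22 : s'.mem 22 = s.mem 22 := by
      rw [hfr 22 (by decide) (by decide), hmem₄ 22 (by decide) (by decide) (by decide) (by decide)]
    rw [hfval j hj]
    simp only [Expr.expand, Expr.spin, Expr.digit, Expr.state, Expr.val_add, Expr.val_mul,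
      Expr.val_div, Expr.val_mod, Expr.val_lit, Expr.val_read, Expr.val_eq, Expr.val_var, h21, h26,
      h22, spin, digit, Expr.val_sub]
    rfl
  · intro s₅ hfr h₅
    refine ⟨_, _, hS.expand hw hwn hadj hct hp ?_ ?_ ?_, h₅⟩
    · rw [hfr 19 (by decide), h₄]
    · intro i; rw [hfr 24 (by decide), hfr₄ 24 (by decide), h₃]; simp [hmem]
    · intro i; rw [hfr 25 (by decide), hfr₄ 25 (by decide), h₃]; simp [hmem]

theorem Represents.congr {m m' : Memory} (h : Represents n adj m) (h0 : m' 0 = m 0)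
    (h1 : m' 1 = m 1) (h2 : m' 2 = m 2) : Represents n adj m' :=
  ⟨by rw [h0, h.order], by rw [h1, h2]; exact h.adj⟩

theorem Wp.neighbor {s : Config} {v w : ℕ} (S : Setting b n t X adj W)
    (hR : Represents n adj s.mem) (h20 : s.mem 20 0 = v) (h23 : s.mem 23 0 = w)
    (hv : v < n) (hw : w < n) (hI : InnerTable adj W n t v w s.mem) :
    Wp ω b .neighbor s (24 * 3 ^ t + 2 * t + 12)
      (fun s' => InnerTable adj W n t v (w + 1) s'.mem) := by
  have hb := S.one_le
  have hval : Expr.adjacent.val s.mem ≠ 0 ↔ adj v w := by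
    simpa [Expr.adjacent, Expr.order, h20, h23, hR.order] using hR.adj v hv w hw
  refine (Wp.ite (N := 24 * 3 ^ t + 2 * t + 11) hb (by decide) ?_ ?_)
  · intro h
    have hadj := hval.1 h
    have hne : v ≠ w := by rintro rfl; exact S.irrefl _ hadj
    refine Wp.ite (N := 24 * 3 ^ t + 2 * t + 10) hb (by decide) ?_ ?_
    · intro hlt
      have hlt : w < v := by
        by_contra hge
        simp [h20, h23, hge] at hlt
      exact (Wp.contract S hR h20 h23 hlt hv (S.symm _ _ hadj) hI).weaken (by omega)
        fun _ _ h => h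
    · intro hlt
      have hlt : v < w := by
        by_contra hge
        simp [h20, h23, show w < v by omega] at hlt
      exact Wp.expand S hR h20 h23 hlt hw hadj hI
  · intro h
    have hadj : ¬ adj v w := fun h' => hval.2 h' h
    have hadj' : ¬ adj w v := fun h' => hadj (S.symm _ _ h')
    refine (Wp.skip hb ?_).weaken (by omega) fun _ _ h => h
    obtain ⟨slots, c, hS, hT⟩ := hI
    rw [doneEdges_of_lt (.inr hadj')] at hT
    refine ⟨slots, c, ⟨hS.size, hS.le, hS.lt, ?_, ?_, hS.used⟩, hT⟩
    · rw [activeEdges_of_not_adj hadj hadj']; exact hS.mem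
    · rw [activeEdges_of_not_adj hadj hadj']; exact hS.ex

/-- `W` is the weight function given by the memory. -/
def Weighted (n : ℕ) (W : ℕ → ℕ → ℕ) (m : Memory) : Prop :=
  ∀ u < n, ∀ s < 4, W u s = if u = m 17 0 ∧ s ≠ 0 then 0 else if s < 2 then m 16 u else 1

theorem Wp.vertex {s : Config} {v : ℕ} (S : Setting b n t X adj W)
    (hR : Represents n adj s.mem) (hW : Weighted n W s.mem) (h20 : s.mem 20 0 = v) (hv : v < n)
    (hO : OuterTable adj W n t v s.mem) :
    Wp ω b .vertex s (n * (24 * 3 ^ t + 2 * t + 14) + (15 * 3 ^ t + 6))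
      (fun s' => OuterTable adj W n t (v + 1) s'.mem) := by
  have hb := S.one_le
  obtain ⟨slots, c, hS, hT⟩ := hO
  have hpow := Nat.pow_le_pow_right (show 0 < 3 by norm_num) hS.le
  -- Splitting the table by the state of `v` costs `12 * 3 ^ c`, summing the states out again `3 * 3
  -- ^ c`; together they give the `15`.
  refine (Wp.seq (N := 4 * 3 ^ c * 3 + 2) (R := fun s' => InnerTable adj W n t v 0 s'.mem) ?_
    (N' := (n * (24 * 3 ^ t + 2 * t + 12 + 2) + 2) + (3 * 3 ^ t + 2)) ?_).weaken (by
      ring_nf; omega) fun _ _ h => h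
  · refine (Wp.fill (by decide) (fun j => stateSum v fun σ => entry W t (v + 1)
      (doneEdges adj n v 0) slots (Function.update σ v (j % 4)) (j / 4)) _ hb (by decide)
      (by decide) (S.pow_lt hS.le) ?_ (fun j _ => S.entry_lt (by omega) hv _ _ _) ?_).weaken
      le_rfl ?_
    · intro s' h; simp [h 19, hS.size]
    · intro j hj s' hfr h21
      have hD : ∀ e ∈ doneEdges adj n v 0, e.1 < v ∧ e.2 < v := by
        intro e he
        simp only [doneEdges, mem_filter] at he
        omega
      have hs : ∀ p e, slots p = some e → e.1 < v := by
        intro p e he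
        have := (hS.mem p e he).1
        simp only [activeEdges, mem_filter] at this
        omega
      have hw : (Expr.weightOf).val s'.mem = W v (j % 4) := by
        rw [hW v hv _ (Nat.mod_lt _ (by norm_num))]
        simp only [Expr.weightOf, Expr.state, Expr.val_add, Expr.val_mul, Expr.val_sub,
          Expr.val_mod, Expr.val_lit, Expr.val_read, Expr.val_eq, Expr.val_lt, Expr.val_var, h21,
          hfr 20 (by decide) (by decide), hfr 17 (by decide) (by decide),
          hfr 16 (by decide) (by decide), h20]
        split_ifs <;> simp_all
      rw [Expr.val_mul, hw]
      simp only [Expr.val_read, Expr.val_div, Expr.val_var, Expr.val_lit, h21,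
        hfr 18 (by decide) (by decide)]
      rw [hT _ (by omega), stateSum_mul]
      simp only [entry_succ (j % 4) hD hs]
    · rintro s₁ hfr ⟨-, h₁⟩
      exact ⟨slots, c, hS.congr (hfr 19 (by decide)) (hfr 24 (by decide)) (hfr 25 (by decide)),
        h₁⟩
  rintro s₁ hfr₁ h₁
  refine Wp.seq (R := fun s' => InnerTable adj W n t v n s'.mem)
    (Wp.loop (fun w s' => InnerTable adj W n t v w s'.mem) n hb (by decide) S.order_lt ?_ ?_ ?_
      (fun s' h _ => h)) ?_
  · intro s' hfr
    simp [Expr.order, hfr 0 (by decide), hfr₁ 0 (by decide), hR.order]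
  · obtain ⟨slots, c, hS, hT⟩ := h₁
    exact ⟨slots, c, hS.congr (by simp) (by simp) (by simp), by simpa using hT⟩
  · intro w s' hw hfr h23 hI
    have hfr' : ∀ a, a ∉ (Prog.loop 23 .order .neighbor).touches → a ≠ 21 → a ≠ 22 →
        s'.mem a = s.mem a := by
      intro a ha h21 h22
      rw [hfr a ha, hfr₁ a (by simp [Prog.touches, Prog.loop, Prog.assign, h21, h22])]
    refine (Wp.neighbor S (hR.congr (hfr' 0 (by decide) (by decide) (by decide))
      (hfr' 1 (by decide) (by decide) (by decide)) (hfr' 2 (by decide) (by decide) (by decide)))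
      (by rw [hfr' 20 (by decide) (by decide) (by decide), h20]) h23 hv hw hI).weaken le_rfl ?_
    rintro s₂ hfr₂ ⟨slots, c, hS, hT⟩
    refine ⟨by rw [hfr₂ 23 (by decide), h23], slots, c, hS.congr (by simp) (by simp) (by simp), ?_⟩
    simpa using hT
  rintro s₂ - ⟨slots, c, hS, hT⟩
  have hpow := Nat.pow_le_pow_right (show 0 < 3 by norm_num) hS.le
  have hpow' := S.pow_lt hS.le
  rw [doneEdges_succ] at hT
  refine (Wp.fill (by decide) (fun x => stateSum (v + 1) fun σ => entry W t (v + 1)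
    (doneEdges adj n (v + 1) 0) slots σ x) (3 ^ c) hb (by decide) (by decide) (by omega) ?_
    (fun j _ => S.entry_lt le_rfl hv _ _ _) ?_).weaken (by omega) ?_
  · intro s' h; simp [h 19, hS.size]
  · intro x hx s' hfr h21
    simp only [Expr.val_add, Expr.val_mul, Expr.val_lit, Expr.val_read, Expr.val_var, h21,
      hfr 22 (by decide) (by decide)]
    have hB : ∀ k < 4, s₂.mem 22 (4 * x + k) = stateSum v fun σ => entry W t (v + 1)
        (doneEdges adj n (v + 1) 0) slots (Function.update σ v k) x := by
      intro k hk
      rw [hT _ (by omega), show (4 * x + k) % 4 = k by omega, show (4 * x + k) / 4 = x by omega]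
    have h0 := hB 0 (by omega)
    rw [add_zero] at h0
    -- Adding the four entries for `x` is exactly the outermost step of `stateSum (v + 1)`.
    rw [stateSum, ← stateSum_sum]
    simp only [sum_range_succ, range_zero, sum_empty, zero_add]
    rw [h0, hB 1 (by omega), hB 2 (by omega), hB 3 (by omega)]
  · rintro s₃ hfr ⟨-, h₃⟩
    have h19 := hfr 19 (by decide)
    have h24 := hfr 24 (by decide)
    have h25 := hfr 25 (by decide)
    refine ⟨slots, c, Slotted.congr ⟨hS.size, hS.le, hS.lt, ?_, ?_, hS.used⟩ h19 h24 h25, h₃⟩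
    · rw [← activeEdges_succ]; exact hS.mem
    · rw [← activeEdges_succ]; exact hS.ex

/-- The weighted number of states, where all edges contribute their interaction. -/
noncomputable def partition {R : Type*} [CommSemiring R] (adj : ℕ → ℕ → Prop) (n : ℕ)
    (W : ℕ → ℕ → R) : R :=
  stateSum n fun σ => (∏ u ∈ range n, W u (σ u)) *
    ∏ e ∈ doneEdges adj n n 0, (bond (σ e.1) (σ e.2) : R)

/-- That all slots end up free belongs to the postcondition, because the computation for the next
root starts in the same memory. -/
theorem Wp.table {s : Config} (S : Setting b n t X adj W)
    (hR : Represents n adj s.mem) (hW : Weighted n W s.mem) (h25 : ∀ p, s.mem 25 (3 ^ p) = 0) :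
    Wp ω b .table s (n * (n * (24 * 3 ^ t + 2 * t + 14) + (15 * 3 ^ t + 8)) + 4)
      (fun s' => s'.mem 18 0 = partition adj n W ∧ ∀ p, s'.mem 25 (3 ^ p) = 0) := by
  have hb := S.one_le
  have h1 : 1 < 2 ^ b := Nat.one_lt_two_pow (by omega)
  refine (Wp.seq (N := 1) (R := fun s' => s'.mem = s.mem.set 18 0 1)
    (Wp.write hb (by decide) (by simpa using h1) (by simp))
    (N' := 1 + (n * (n * (24 * 3 ^ t + 2 * t + 14) + (15 * 3 ^ t + 6) + 2) + 2)) ?_).weaken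
    (by ring_nf; omega) fun _ _ h => h
  rintro s₁ - h₁
  refine Wp.seq (R := fun s' => s'.mem = (s.mem.set 18 0 1).set 19 0 1)
    (Wp.assign hb (by decide) (by simpa using h1) (by simp [h₁])) ?_
  rintro s₂ - h₂
  refine Wp.loop (fun v s' => OuterTable adj W n t v s'.mem) n hb (by decide) S.order_lt ?_ ?_ ?_ ?_
  · intro s' hfr
    simp [Expr.order, hfr 0 (by decide), h₂, hR.order]
  · refine ⟨fun _ => none, 0, ⟨by simp [h₂], Nat.zero_le _, by simp, by simp, ?_, ?_⟩, ?_⟩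
    · simp [activeEdges_zero]
    · simpa [h₂] using h25
    · intro x hx
      obtain rfl : x = 0 := by simpa using hx
      simp [h₂, stateSum, entry, doneEdges_zero, leg_none, digit]
  · intro v s' hv hfr h20 hO
    have hmem : ∀ a, a ∉ (Prog.loop 20 .order .vertex).touches → a ≠ 18 → a ≠ 19 →
        s'.mem a = s.mem a := by
      intro a ha h18 h19
      rw [hfr a ha, h₂]
      simp [h18, h19]
    have hW' : Weighted n W s'.mem := by
      unfold Weighted
      rw [hmem 16 (by decide) (by decide) (by decide), hmem 17 (by decide) (by decide) (by decide)]
      exact hW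
    refine (Wp.vertex S (hR.congr (hmem 0 (by decide) (by decide) (by decide))
      (hmem 1 (by decide) (by decide) (by decide)) (hmem 2 (by decide) (by decide) (by decide)))
      hW' h20 hv hO).weaken le_rfl ?_
    rintro s₃ hfr₃ ⟨slots, c, hS, hT⟩
    refine ⟨by rw [hfr₃ 20 (by decide), h20], slots, c, hS.congr (by simp) (by simp) (by simp), ?_⟩
    simpa using hT
  · rintro s' ⟨slots, c, hS, hT⟩ -
    have hnone : ∀ p, slots p = none := by
      intro p
      by_contra h
      obtain ⟨e, he⟩ := Option.ne_none_iff_exists'.1 h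
      simpa [activeEdges_last] using (hS.mem p e he).1
    refine ⟨?_, fun p => by_contra fun h => (hS.used p).1 h (hnone p)⟩
    -- No edge is active at the end, so all legs are trivial and entry `0` is the whole sum.
    rw [hT 0 (by positivity)]
    simp [partition, entry, hnone, leg_none, digit]

end

/-! ### The complete program -/

/-- Computing the base and its power. -/
def Prog.powers : Prog :=
  .seq (.assign 10 (.lit 1))
    (.seq (.loop 12 ((.order + .lit 1) * (.order + .lit 1)) (.assign 10 (.var 10 * .lit 16)))
      (.seq (.assign 11 (.lit 1)) (.loop 12 (.order * .order) (.assign 11 (.var 11 * .var 10)))))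

/-- Choosing the random weights. -/
def Prog.weights : Prog :=
  .loop 12 .order
    (.seq (.assign 15 (.lit 0))
      (.seq (.loop 13 .order
          (.seq (.toss 14 (.lit 0)) (.assign 15 (.var 15 * .var 10 + .var 14))))
        (.write 16 (.var 12) (.var 15 * .var 11))))

/-- Searching for an odd digit at an admissible place. -/
def Prog.scan : Prog :=
  .seq (.assign 28 (.read 18 (.lit 0)))
    (.loop 29 ((.order + .lit 1) * (.order * .order))
      (.seq
        (.ite (.var 28 % .lit 2 *
            .op .lt (.var 29) ((.read 0 (.lit 1) + .lit 1) * (.order * .order)) *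
            (.lit 1 - .read 0 (.lit 2)))
          (.assign 3 (.lit 1)) .skip)
        (.assign 28 (.var 28 / .var 10))))

/-- The algorithm for Connected Dominating Set. -/
def Prog.main : Prog :=
  .seq .powers (.seq .weights (.loop 17 .order (.seq .table .scan)))

/-- The number with the first `j` values of `f` as digits in base `β`. -/
def horner {R : Type*} [Semiring R] (β : R) (f : ℕ → Bool) : ℕ → R
  | 0 => 0
  | j + 1 => horner β f j * β + ((f j).toNat : R)

theorem horner_lt {β : ℕ} (hβ : 2 ≤ β) (f : ℕ → Bool) (j : ℕ) : horner β f j < β ^ j := by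
  induction j with
  | zero => simp [horner]
  | succ j ih =>
    have := Bool.toNat_le (f j)
    simp only [horner, pow_succ, Nat.cast_id]
    nlinarith

/-- The weight of state `s` of vertex `u`, if the solution has to contain `r` on the left side. -/
def rootWeight {R : Type*} [Semiring R] (x : ℕ → R) (r u s : ℕ) : R :=
  if u = r ∧ s ≠ 0 then 0 else if s < 2 then x u else 1

/-- The base for packing polynomials into numbers. -/
def base (n : ℕ) : ℕ := 16 ^ ((n + 1) * (n + 1))

theorem two_le_base (n : ℕ) : 2 ≤ base n :=
  (show 2 ≤ 16 ^ 1 by norm_num).trans (Nat.pow_le_pow_right (by norm_num) (by nlinarith))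

/-- The packed random weight of a vertex. -/
def packedWeight (n : ℕ) (ω : ℕ → Bool) (u : ℕ) : ℕ :=
  horner (base n) (fun j => ω (u * n + j)) n * base n ^ (n * n)

/-- The numbers that occur fit into `b` bits. -/
structure Fits (b n t : ℕ) : Prop where
  base_lt : base n < 2 ^ b
  power_lt : base n ^ (n + n * n) < 2 ^ b
  count_lt : (n + 1) * (n * n) < 2 ^ b
  count_lt' : (n + 1) * (n + 1) < 2 ^ b
  size_lt : 12 * 3 ^ t < 2 ^ b
  value_lt : ∀ v ≤ n, 4 ^ v * ((base n ^ (n + n * n)) ^ v * 3 ^ (n * n)) < 2 ^ b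

section

variable {ω : ℕ → Bool} {b n t : ℕ} {adj : ℕ → ℕ → Prop}

theorem Fits.one_le (F : Fits b n t) : 1 ≤ b := by
  by_contra h
  have := F.base_lt
  have := two_le_base n
  rw [show b = 0 by omega] at *
  omega

theorem Fits.order_lt (F : Fits b n t) : n < 2 ^ b := by
  have := F.count_lt'
  nlinarith

theorem packedWeight_lt (u : ℕ) : packedWeight n ω u < base n ^ (n + n * n) := by
  have := two_le_base n
  rw [packedWeight, pow_add]
  exact Nat.mul_lt_mul_of_pos_right (horner_lt this _ _) (by positivity)

theorem Fits.setting (F : Fits b n t) (symm : ∀ u w, adj u w → adj w u)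
    (irrefl : ∀ u, ¬ adj u u) (cut : ∀ v < n, (activeEdges adj n (v + 1) 0).card ≤ t) (r : ℕ) :
    Setting b n t (base n ^ (n + n * n)) adj (rootWeight (packedWeight n ω) r) where
  symm := symm
  irrefl := irrefl
  cut := cut
  weight_le u s := by
    have := two_le_base n
    unfold rootWeight
    split_ifs
    · exact Nat.zero_le _
    · exact (packedWeight_lt u).le
    · exact Nat.one_le_pow _ _ (by omega)
  size_lt := F.size_lt
  order_lt := F.order_lt
  value_lt := F.value_lt

theorem Wp.powers {s : Config} (F : Fits b n t) (h0 : s.mem 0 0 = n) :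
    Wp ω b .powers s (6 * ((n + 1) * (n + 1)) + 6) (fun s' => s'.tossed = s.tossed ∧
      s'.mem 10 0 = base n ∧ s'.mem 11 0 = base n ^ (n * n)) := by
  have hb := F.one_le
  have h2 := two_le_base n
  have h1 : 1 < 2 ^ b := Nat.one_lt_two_pow (by omega)
  refine (Wp.seq (N := 1) (R := fun s' => s' = ⟨s.mem.set 10 0 1, s.tossed⟩)
    (Wp.assign hb (by decide) (by simpa using h1) (by simp))
    (N' := ((n + 1) * (n + 1) * (1 + 2) + 2) + (1 + (n * n * (1 + 2) + 2)))
    ?_).weaken (by ring_nf; omega) fun _ _ h => h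
  rintro s₁ - rfl
  refine Wp.seq (R := fun s' => s'.tossed = s.tossed ∧ s'.mem 10 0 = base n)
    (Wp.loop (fun i s' => s'.tossed = s.tossed ∧ s'.mem 10 0 = 16 ^ i) ((n + 1) * (n + 1)) hb
      (by decide) F.count_lt' ?_ (by simp) ?_ (fun s' h _ => h)) ?_
  · intro s' hfr
    simp [Expr.order, hfr 0 (by decide), h0]
  · rintro i s' hi hfr h12 ⟨ht, h10⟩
    have hval : (Expr.var 10 * .lit 16).val s'.mem = 16 ^ (i + 1) := by simp [h10, pow_succ]
    refine Wp.assign hb (by decide) ?_ ?_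
    · rw [hval]
      exact lt_of_le_of_lt (Nat.pow_le_pow_right (by norm_num) hi) F.base_lt
    · rw [hval]; simp [ht, h12]
  rintro s₁ hfr₁ ⟨ht₁, h10₁⟩
  have h0₁ : s₁.mem 0 0 = n := by rw [hfr₁ 0 (by decide)]; simpa using h0
  refine Wp.seq (R := fun s' => s' = ⟨s₁.mem.set 11 0 1, s₁.tossed⟩)
    (Wp.assign hb (by decide) (by simpa using h1) (by simp)) ?_
  rintro s₂ - rfl
  refine (Wp.loop (Q := fun s' => s'.tossed = s.tossed ∧ s'.mem 11 0 = base n ^ (n * n))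
    (fun i s' => s'.tossed = s.tossed ∧ s'.mem 11 0 = base n ^ i) (n * n) hb
    (by decide) (lt_of_le_of_lt (by nlinarith) F.count_lt') ?_ (by simp [ht₁]) ?_
    (fun s' h _ => h)).weaken le_rfl
    fun s' hfr h => ⟨h.1, by rw [hfr 10 (by decide)]; simpa using h10₁, h.2⟩
  · intro s' hfr
    simp [Expr.order, hfr 0 (by decide), h0₁]
  · rintro i s' hi hfr h12 ⟨ht, h11⟩
    have hval : (Expr.var 11 * .var 10).val s'.mem = base n ^ (i + 1) := by
      simp [h11, hfr 10 (by decide), h10₁, pow_succ]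
    refine Wp.assign hb (by decide) ?_ ?_
    · rw [hval]
      exact lt_of_le_of_lt (Nat.pow_le_pow_right (by omega) (by omega)) F.power_lt
    · rw [hval]; simp [ht, h12]

/-- The invariant counts tosses so that the vertex at position `u` receives exactly the coins `u * n
+ j` with `j < n`; different vertices use disjoint blocks. -/
theorem Wp.weights {s : Config} (F : Fits b n t) (h0 : s.mem 0 0 = n) (hs : s.tossed = 0)
    (h10 : s.mem 10 0 = base n) (h11 : s.mem 11 0 = base n ^ (n * n)) :
    Wp ω b .weights s (n * (4 * n + 6) + 2)
      (fun s' => ∀ u < n, s'.mem 16 u = packedWeight n ω u) := by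
  have hb := F.one_le
  have h2 := two_le_base n
  refine (Wp.loop (N := 1 + ((n * (1 + 1 + 2) + 2) + 1))
    (fun i s' => s'.tossed = i * n ∧ ∀ u < i, s'.mem 16 u = packedWeight n ω u) n hb
    (by decide) F.order_lt ?_ (by simp [hs]) ?_ (fun s' h _ => h.2)).weaken
    (by ring_nf; omega) fun _ _ h => h
  · intro s' hfr
    simp [Expr.order, hfr 0 (by decide), h0]
  rintro i s' hi hfr h12 ⟨ht, h16⟩
  refine Wp.seq (R := fun s₁ => s₁ = ⟨s'.mem.set 15 0 0, s'.tossed⟩)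
    (Wp.assign hb (by decide) (by simp) (by simp)) ?_
  rintro s₁ - rfl
  refine Wp.seq (R := fun s₂ => s₂.tossed = i * n + n ∧
      s₂.mem 15 0 = horner (base n) (fun j => ω (i * n + j)) n)
    (Wp.loop (fun j s₂ => s₂.tossed = i * n + j ∧
      s₂.mem 15 0 = horner (base n) (fun j => ω (i * n + j)) j) n hb (by decide) F.order_lt ?_
      (by simp [ht, horner]) ?_ (fun s' h _ => h)) ?_
  · intro s₂ hfr₂
    simp [Expr.order, hfr₂ 0 (by decide), hfr 0 (by decide), h0]
  · rintro j s₂ hj hfr₂ h13 ⟨ht₂, h15⟩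
    refine Wp.seq (R := fun s₃ => s₃ = ⟨s₂.mem.set 14 0 (ω (i * n + j)).toNat, s₂.tossed + 1⟩)
      (Wp.toss hb (by decide) (by simp [ht₂])) ?_
    rintro s₃ - rfl
    have hval : (Expr.var 15 * .var 10 + .var 14).val
        (s₂.mem.set 14 0 (ω (i * n + j)).toNat) =
        horner (base n) (fun j => ω (i * n + j)) (j + 1) := by
      simp [h15, hfr₂ 10 (by decide), hfr 10 (by decide), h10, horner]
    refine Wp.assign hb (by decide) ?_ ?_
    · rw [hval]
      exact ((horner_lt h2 _ _).trans_le (Nat.pow_le_pow_right (by omega) (by omega))).trans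
        F.power_lt
    · rw [hval]; simp [ht₂, h13, add_assoc]
  rintro s₂ hfr₂ ⟨ht₂, h15⟩
  have hval : (Expr.var 15 * .var 11).val s₂.mem = packedWeight n ω i := by
    simp [h15, hfr₂ 11 (by decide), hfr 11 (by decide), h11, packedWeight]
  have h12₂ : s₂.mem 12 0 = i := by rw [hfr₂ 12 (by decide)]; simpa using h12
  refine Wp.write hb (by decide) ?_ ?_
  · rw [hval]
    exact (packedWeight_lt i).trans F.power_lt
  · rw [hval]
    refine ⟨by simp [h12₂], by simp [ht₂]; ring, fun u hu => ?_⟩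
    simp only [Expr.val_var, h12₂]
    by_cases hui : u = i
    · simp [hui]
    · simp [hui, hfr₂ 16 (by decide), h16 u (by omega)]

/-- A set of cardinality `j` contributes to exponents from `j * (n * n)` to below `(j + 1) * (n *
n)`, hence the threshold `(|k| + 1) * (n * n)`. The loop bound depends on `n` alone, so a huge `k`
does not prolong the search. -/
theorem Wp.scan {s : Config} (F : Fits b n t) (h0 : s.mem 0 0 = n) (h10 : s.mem 10 0 = base n) :
    Wp ω b .scan s ((n + 1) * (n * n) * 5 + 3) (fun s' => s'.mem 3 0 ≠ 0 ↔ s.mem 3 0 ≠ 0 ∨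
      ∃ e < (n + 1) * (n * n), s.mem 18 0 / base n ^ e % 2 ≠ 0 ∧
        e < (s.mem 0 1 + 1) * (n * n) ∧ s.mem 0 2 = 0) := by
  have hb := F.one_le
  intro hbd
  revert hbd
  refine Wp.of_bounded fun hbd => ?_
  set Z := s.mem 18 0 with hZ
  refine (Wp.seq (N := 1) (R := fun s' => s' = ⟨s.mem.set 28 0 Z, s.tossed⟩)
    (Wp.assign hb (by decide) (by simpa [← hZ] using hbd 18 0) (by simp [hZ]))
    (N' := (n + 1) * (n * n) * ((1 + 1 + 1) + 2) + 2) ?_).weaken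
    (by ring_nf; omega) fun _ _ h => h
  rintro s₁ - rfl
  refine Wp.loop (fun i s' => s'.mem 28 0 = Z / base n ^ i ∧ (s'.mem 3 0 ≠ 0 ↔ s.mem 3 0 ≠ 0 ∨
      ∃ e < i, Z / base n ^ e % 2 ≠ 0 ∧ e < (s.mem 0 1 + 1) * (n * n) ∧ s.mem 0 2 = 0)) _ hb
    (by decide) F.count_lt ?_ (by simp) ?_ (fun s' h _ => h.2)
  · intro s' hfr
    simp [Expr.order, hfr 0 (by decide), h0]
  rintro i s' hi hfr h29 ⟨h28, h3⟩
  have h00 : s'.mem 0 = s.mem 0 := by rw [hfr 0 (by decide)]; simp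
  have hcond : (Expr.var 28 % .lit 2 *
      .op .lt (.var 29) ((.read 0 (.lit 1) + .lit 1) * (.order * .order)) *
      (.lit 1 - .read 0 (.lit 2)) : Expr).val s'.mem ≠ 0 ↔
      Z / base n ^ i % 2 ≠ 0 ∧ i < (s.mem 0 1 + 1) * (n * n) ∧ s.mem 0 2 = 0 := by
    simp only [Expr.val_mul, Expr.val_mod, Expr.val_lt, Expr.val_sub, Expr.val_var, Expr.val_lit,
      Expr.val_read, Expr.val_add, Expr.order, h28, h29, h00, h0, mul_ne_zero_iff, and_assoc]
    refine and_congr Iff.rfl (and_congr (by split_ifs <;> simp_all) (by omega))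
  refine Wp.seq (N := 1 + 1) (N' := 1) (R := fun s₂ => s₂.mem 3 0 ≠ 0 ↔ s.mem 3 0 ≠ 0 ∨
      ∃ e < i + 1, Z / base n ^ e % 2 ≠ 0 ∧ e < (s.mem 0 1 + 1) * (n * n) ∧ s.mem 0 2 = 0) ?_ ?_
  · refine Wp.ite hb (by decide) ?_ ?_
    · intro h
      refine Wp.assign hb (by decide) (by simpa using Nat.one_lt_two_pow (by omega)) ?_
      simp only [Memory.set_self, if_true, Expr.val_lit, ne_eq, one_ne_zero, not_false_eq_true,
        true_iff]
      exact .inr ⟨i, by omega, hcond.1 h⟩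
    · intro h
      refine Wp.skip hb (h3.trans (or_congr Iff.rfl ⟨?_, ?_⟩))
      · rintro ⟨e, he, h'⟩; exact ⟨e, by omega, h'⟩
      · rintro ⟨e, he, h'⟩
        rcases Nat.lt_succ_iff_lt_or_eq.1 he with he | rfl
        · exact ⟨e, he, h'⟩
        · exact absurd h (hcond.2 h')
  rintro s₂ hfr₂ h₂
  have hval : (Expr.var 28 / .var 10).val s₂.mem = Z / base n ^ (i + 1) := by
    simp [hfr₂ 28 (by decide), hfr₂ 10 (by decide), hfr 10 (by decide), h10, h28,
      Nat.div_div_eq_div_mul, pow_succ]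
  refine Wp.assign hb (by decide) ?_ ?_
  · rw [hval]
    exact lt_of_le_of_lt (Nat.div_le_self _ _) (hbd 18 0)
  · rw [hval]
    refine ⟨?_, by simp, ?_⟩
    · simp [hfr₂ 29 (by decide), h29]
    · simpa using h₂

/-- The number of steps of the algorithm. -/
def steps (n t : ℕ) : ℕ :=
  (6 * ((n + 1) * (n + 1)) + 6) + ((n * (4 * n + 6) + 2) +
    (n * ((n * (n * (24 * 3 ^ t + 2 * t + 14) + (15 * 3 ^ t + 8)) + 4) +
      ((n + 1) * (n * n) * 5 + 3) + 2) + 2))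

theorem Wp.main {m : Memory} (F : Fits b n t) (symm : ∀ u w, adj u w → adj w u)
    (irrefl : ∀ u, ¬ adj u u) (cut : ∀ v < n, (activeEdges adj n (v + 1) 0).card ≤ t)
    (hR : Represents n adj m) (h25 : ∀ i, m 25 i = 0) (h3 : m 3 0 = 0) :
    Wp ω b .main ⟨m, 0⟩ (steps n t) (fun s' => s'.mem 3 0 ≠ 0 ↔
      ∃ r < n, ∃ e < (n + 1) * (n * n),
        partition adj n (rootWeight (packedWeight n ω) r) / base n ^ e % 2 ≠ 0 ∧
        e < (m 0 1 + 1) * (n * n) ∧ m 0 2 = 0) := by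
  have hb := F.one_le
  refine Wp.seq (Wp.powers F hR.order) ?_
  rintro s₁ hfr₁ ⟨ht₁, h10₁, h11₁⟩
  refine Wp.seq (Wp.weights F (by rw [hfr₁ 0 (by decide)]; exact hR.order) ht₁ h10₁ h11₁) ?_
  rintro s₂ hfr₂ h16
  -- One set of coin tosses serves all roots; the answer flag is only ever raised, so one successful
  -- root is enough.
  refine Wp.loop (fun r s' => (∀ p, s'.mem 25 (3 ^ p) = 0) ∧ (s'.mem 3 0 ≠ 0 ↔
      ∃ r' < r, ∃ e < (n + 1) * (n * n),
        partition adj n (rootWeight (packedWeight n ω) r') / base n ^ e % 2 ≠ 0 ∧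
        e < (m 0 1 + 1) * (n * n) ∧ m 0 2 = 0)) n hb (by decide) F.order_lt ?_ ?_ ?_
    (fun s' h _ => h.2)
  · intro s' hfr
    simp [Expr.order, hfr 0 (by decide), hfr₂ 0 (by decide), hfr₁ 0 (by decide), hR.order]
  · simp [hfr₂ 25 (by decide), hfr₁ 25 (by decide), h25, hfr₂ 3 (by decide), hfr₁ 3 (by decide),
      h3]
  rintro r s' hr hfr h17 ⟨h25', h3'⟩
  have hmem : ∀ a, a ∉ Prog.main.touches → s'.mem a = m a := by
    intro a ha
    simp only [Prog.main, Prog.touches, List.mem_append, not_or] at ha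
    rw [hfr a ha.2.2, hfr₂ a ha.2.1, hfr₁ a ha.1]
  have hW : Weighted n (rootWeight (packedWeight n ω) r) s'.mem := by
    intro u hu s hs
    rw [h17, hfr 16 (by decide), h16 u hu]
    rfl
  refine Wp.seq (Wp.table (F.setting symm irrefl cut r)
    (hR.congr (hmem 0 (by decide)) (hmem 1 (by decide)) (hmem 2 (by decide))) hW h25') ?_
  rintro s₃ hfr₃ ⟨h18, h25₃⟩
  have h0₃ : s₃.mem 0 = m 0 := by rw [hfr₃ 0 (by decide), hmem 0 (by decide)]
  refine (Wp.scan F (by rw [h0₃]; exact hR.order) (by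
    rw [hfr₃ 10 (by decide), hfr 10 (by decide), hfr₂ 10 (by decide), h10₁])).weaken le_rfl ?_
  rintro s₄ hfr₄ h₄
  refine ⟨by rw [hfr₄ 17 (by decide), hfr₃ 17 (by decide), h17], ?_, ?_⟩
  · intro p
    simp [hfr₄ 25 (by decide), h25₃]
  · change s₄.mem.set 17 0 (r + 1) 3 0 ≠ 0 ↔ _
    rw [Memory.set_ne _ _ _ (by decide), h₄, hfr₃ 3 (by decide), h3', h18, h0₃]
    constructor
    · rintro (⟨r', hr', h⟩ | h)
      · exact ⟨r', by omega, h⟩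
      · exact ⟨r, by omega, h⟩
    · rintro ⟨r', hr', h⟩
      rcases Nat.lt_succ_iff_lt_or_eq.1 hr' with hr' | rfl
      · exact .inl ⟨r', hr', h⟩
      · exact .inr h

end

/-! ### The partition function in characteristic two -/

/-- Two states that may occur at adjacent vertices. -/
def Compatible (s s' : Fin 4) : Prop := bond s s' % 2 = 1

instance (s s' : Fin 4) : Decidable (Compatible s s') :=
  inferInstanceAs (Decidable (bond s s' % 2 = 1))

theorem Compatible.symm {s s' : Fin 4} (h : Compatible s s') : Compatible s' s := by
  revert s s'; decide

theorem cast_eq_ite_of_char_two {R : Type*} [CommRing R] (h2 : (2 : R) = 0) (k : ℕ) :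
    (k : R) = if k % 2 = 1 then 1 else 0 := by
  conv_lhs => rw [← Nat.div_add_mod k 2]
  push_cast
  rw [h2, zero_mul, zero_add]
  rcases Nat.mod_two_eq_zero_or_one k with h | h <;> simp [h]

/-- The adjacency relation of a graph on `Fin n`, for natural numbers. -/
def natAdj {n : ℕ} (H : SimpleGraph (Fin n)) (u w : ℕ) : Prop :=
  ∃ (hu : u < n) (hw : w < n), H.Adj ⟨u, hu⟩ ⟨w, hw⟩

section CharTwo

variable {n : ℕ} (H : SimpleGraph (Fin n))

/-- All edges have compatible states. -/
def Good (σ : Fin n → Fin 4) : Prop := ∀ u w, H.Adj u w → Compatible (σ u) (σ w)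

/-- The vertices whose state puts them into the solution. -/
def chosen (σ : Fin n → Fin 4) : Finset (Fin n) := univ.filter fun u => (σ u : ℕ) < 2

/-- Exchanging the states `a` and `b` at the vertices in `C`. -/
def toggle (C : Finset (Fin n)) (a b : Fin 4) (σ : Fin n → Fin 4) : Fin n → Fin 4 :=
  fun u => if u ∈ C then Equiv.swap a b (σ u) else σ u

variable {R : Type*} [CommRing R]

open Classical in
/-- The contribution of `σ`. -/
noncomputable def contribution (x : ℕ → R) (r : Fin n) (σ : Fin n → Fin 4) : R :=
  if Good H σ then ∏ u : Fin n, rootWeight x r u (σ u) else 0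

/-- Modulo 2 each `bond` is the indicator of compatibility, so the product over the edges is the
indicator of `Good`. The edges are listed upwards only; symmetry of `Compatible` supplies the other
orientation. -/
theorem partition_eq_sum (h2 : (2 : R) = 0) (x : ℕ → R) (r : Fin n) :
    partition (natAdj H) n (rootWeight x r) = ∑ σ : Fin n → Fin 4, contribution H x r σ := by
  classical
  rw [partition, stateSum_eq_sum]
  refine Fintype.sum_congr _ _ fun σ => ?_
  have hσ : ∀ u : Fin n, (if h : (u : ℕ) < n then ((σ ⟨u, h⟩ : Fin 4) : ℕ) else 0) = σ u :=
    fun u => by rw [dif_pos u.2]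
  simp only [cast_eq_ite_of_char_two h2, contribution]
  rw [prod_ite_zero, prod_range]
  simp only [hσ, prod_const_one]
  rw [mul_ite, mul_one, mul_zero]
  refine if_congr ⟨fun h => ?_, fun h e he => ?_⟩ rfl rfl
  · have key : ∀ u w : Fin n, u < w → H.Adj u w → Compatible (σ u) (σ w) := by
      intro u w huw hadj
      have := h ((u : ℕ), (w : ℕ)) (by simp [doneEdges, natAdj, hadj, huw])
      simpa [hσ, Compatible] using this
    intro u w hadj
    rcases lt_trichotomy u w with huw | rfl | huw
    · exact key u w huw hadj
    · exact absurd hadj (H.irrefl)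
    · exact (key w u huw hadj.symm).symm
  · obtain ⟨hu, hw, hadj⟩ := (mem_filter.1 he).2.1
    have := h _ _ hadj
    simpa [hu, hw, Compatible] using this

theorem toggle_toggle (C : Finset (Fin n)) (a b : Fin 4) (σ : Fin n → Fin 4) :
    toggle C a b (toggle C a b σ) = σ := by
  funext u
  by_cases h : u ∈ C <;> simp [toggle, h]

/-- Toggling is an involution, and it moves every assignment in `Ω` because it changes the state of
`u₀`. The two members of each pair add up to `2 * f σ = 0`. -/
theorem sum_eq_zero_of_toggle (h2 : (2 : R) = 0) {f : (Fin n → Fin 4) → R}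
    {Ω : Finset (Fin n → Fin 4)} {C : Finset (Fin n)} {u₀ : Fin n} (hu₀ : u₀ ∈ C) {a b : Fin 4}
    (hab : a ≠ b) (hC : ∀ σ ∈ Ω, σ u₀ = a ∨ σ u₀ = b) (hΩ : ∀ σ ∈ Ω, toggle C a b σ ∈ Ω)
    (hf : ∀ σ ∈ Ω, f (toggle C a b σ) = f σ) : ∑ σ ∈ Ω, f σ = 0 := by
  refine sum_involution (fun σ _ => toggle C a b σ) (fun σ hσ => ?_) (fun σ hσ _ heq => ?_) hΩ
    (fun σ _ => toggle_toggle C a b σ)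
  · rw [hf σ hσ, ← two_mul, h2, zero_mul]
  · have := congrFun heq u₀
    rcases hC σ hσ with h | h <;> simp [toggle, hu₀, h, hab, hab.symm] at this

variable {H}

theorem contribution_toggle (x : ℕ → R) (r : Fin n)
    {C : Finset (Fin n)} {a b : Fin 4} {σ : Fin n → Fin 4}
    (hgood : Good H (toggle C a b σ) ↔ Good H σ)
    (hw : ∀ u ∈ C, rootWeight x r u (Equiv.swap a b (σ u)) = rootWeight x r u (σ u)) :
    contribution H x r (toggle C a b σ) = contribution H x r σ := by
  classical
  unfold contribution
  refine if_congr hgood (prod_congr rfl fun u _ => ?_) rfl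
  by_cases hu : u ∈ C
  · simp [toggle, hu, hw u hu]
  · simp [toggle, hu]

/-- For an involution preserving `Ω`, one implication gives the other. -/
theorem good_toggle_iff {C : Finset (Fin n)} {a b : Fin 4} {Ω : Finset (Fin n → Fin 4)}
    (hΩ : ∀ σ ∈ Ω, toggle C a b σ ∈ Ω) (h : ∀ σ ∈ Ω, Good H σ → Good H (toggle C a b σ))
    {σ : Fin n → Fin 4} (hσ : σ ∈ Ω) : Good H (toggle C a b σ) ↔ Good H σ :=
  ⟨fun hg => by simpa [toggle_toggle] using h _ (hΩ σ hσ) hg, h σ hσ⟩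

/-- The states with given chosen vertices. -/
def fiber (S : Finset (Fin n)) : Finset (Fin n → Fin 4) := univ.filter fun σ => chosen σ = S

theorem mem_fiber {S : Finset (Fin n)} {σ : Fin n → Fin 4} :
    σ ∈ fiber S ↔ ∀ u, (σ u : ℕ) < 2 ↔ u ∈ S := by
  simp [fiber, chosen, Finset.ext_iff]

theorem toggle_mem_fiber {S C : Finset (Fin n)} {a b : Fin 4} (hab : (a : ℕ) < 2 ↔ (b : ℕ) < 2)
    {σ : Fin n → Fin 4} (hσ : σ ∈ fiber S) : toggle C a b σ ∈ fiber S := by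
  rw [mem_fiber] at hσ ⊢
  intro u
  rw [← hσ u, toggle]
  split_ifs
  · generalize σ u = s
    revert a b s
    decide
  · rfl

/-- States are lost in pairs if a vertex is not dominated. -/
theorem sum_fiber_of_not_dominating (h2 : (2 : R) = 0) (x : ℕ → R) {r : Fin n}
    {S : Finset (Fin n)} (hr : r ∈ S) (h : ¬ IsDominating H S) :
    ∑ σ ∈ fiber S, contribution H x r σ = 0 := by
  simp only [IsDominating, not_forall, not_exists, not_and] at h
  obtain ⟨v, hv, hvS⟩ := h
  have hΩ : ∀ σ ∈ fiber S, toggle {v} 2 3 σ ∈ fiber S := fun σ => toggle_mem_fiber (by decide)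
  have hstate : ∀ σ ∈ fiber S, σ v = 2 ∨ σ v = 3 := by
    intro σ hσ
    have := mt (mem_fiber.1 hσ v).1 hv
    generalize σ v = s at this ⊢
    revert s; decide
  have hvr : v ≠ r := by rintro rfl; exact hv hr
  refine sum_eq_zero_of_toggle h2 (mem_singleton_self v) (by decide) hstate hΩ fun σ hσ =>
    contribution_toggle x r (good_toggle_iff hΩ ?_ hσ) ?_
  · intro σ hσ hg u w hadj
    have hout : ∀ u, H.Adj v u → ¬ (σ u : ℕ) < 2 := fun u hu h' =>
      hvS u ((mem_fiber.1 hσ u).1 h') hu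
    have hsv := mt (mem_fiber.1 hσ v).1 hv
    -- The states `2` and `3` are compatible with themselves and each other, and no neighbor of `v`
    -- is chosen, so both are open to `v`.
    have key : ∀ s s' : Fin 4, ¬ (s : ℕ) < 2 → ¬ (s' : ℕ) < 2 →
        Compatible (Equiv.swap 2 3 s) s' := by decide
    simp only [toggle, mem_singleton]
    by_cases huv : u = v
    · subst huv
      rw [if_pos rfl, if_neg hadj.ne']
      exact key _ _ hsv (hout w hadj)
    · rw [if_neg huv]
      by_cases hwv : w = v
      · subst hwv
        rw [if_pos rfl]
        exact (key _ _ hsv (hout u hadj.symm)).symm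
      · rw [if_neg hwv]
        exact hg u w hadj
  · intro u hu
    rw [mem_singleton.1 hu]
    rcases hstate σ hσ with h | h <;>
      simp [h, rootWeight, Fin.val_inj, hvr]

/-- States are lost in pairs if the chosen vertices are not connected. -/
theorem sum_fiber_of_not_connected (h2 : (2 : R) = 0) (x : ℕ → R) {r : Fin n}
    {S : Finset (Fin n)} (hr : r ∈ S) (h : ¬ (H.induce (S : Set (Fin n))).Connected) :
    ∑ σ ∈ fiber S, contribution H x r σ = 0 := by
  classical
  set K := H.induce (S : Set (Fin n)) with hK
  -- The chosen vertices outside the component of the root; toggling them leaves the forced state of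
  -- `r` alone.
  set C : Finset (Fin n) := univ.filter fun u =>
    ∃ hu : u ∈ S, ¬ K.Reachable ⟨r, hr⟩ ⟨u, hu⟩ with hC
  have hmem : ∀ u, u ∈ C ↔ ∃ hu : u ∈ S, ¬ K.Reachable ⟨r, hr⟩ ⟨u, hu⟩ := by simp [hC]
  obtain ⟨u₀, hu₀⟩ : ∃ u₀, u₀ ∈ C := by
    by_contra hcon
    push Not at hcon
    have hreach : ∀ u : (S : Set (Fin n)), K.Reachable ⟨r, hr⟩ u := by
      intro u
      by_contra hu
      exact hcon u.1 ((hmem _).2 ⟨u.2, hu⟩)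
    have : Nonempty (S : Set (Fin n)) := ⟨⟨r, hr⟩⟩
    exact h ⟨fun u w => (hreach u).symm.trans (hreach w)⟩
  have hΩ : ∀ σ ∈ fiber S, toggle C 0 1 σ ∈ fiber S := fun σ => toggle_mem_fiber (by decide)
  have hstate : ∀ σ ∈ fiber S, ∀ u ∈ C, σ u = 0 ∨ σ u = 1 := by
    intro σ hσ u hu
    have := (mem_fiber.1 hσ u).2 ((hmem u).1 hu).1
    generalize σ u = s at this ⊢
    revert s; decide
  have hclosed : ∀ u w, H.Adj u w → u ∈ C → w ∉ C → w ∉ S := by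
    intro u w hadj hu hw hwS
    obtain ⟨huS, hur⟩ := (hmem u).1 hu
    refine hw ((hmem w).2 ⟨hwS, fun hwr => hur (hwr.trans ?_)⟩)
    exact SimpleGraph.Adj.reachable (G := K) (u := ⟨w, hwS⟩) (v := ⟨u, huS⟩) hadj.symm
  refine sum_eq_zero_of_toggle h2 hu₀ (by decide) (fun σ hσ => hstate σ hσ u₀ hu₀) hΩ fun σ hσ =>
    contribution_toggle x r (good_toggle_iff hΩ ?_ hσ) ?_
  · intro σ hσ hg u w hadj
    have key₁ : ∀ s s' : Fin 4, Compatible s s' →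
        Compatible (Equiv.swap 0 1 s) (Equiv.swap 0 1 s') := by decide
    -- An unchosen vertex compatible with a chosen one has state `3`, which tolerates both sides of
    -- the cut.
    have key₂ : ∀ s s' : Fin 4, ¬ (s' : ℕ) < 2 → Compatible s s' →
        Compatible (Equiv.swap 0 1 s) s' := by decide
    have hout : ∀ w, w ∉ S → ¬ (σ w : ℕ) < 2 := fun w hw h' => hw ((mem_fiber.1 hσ w).1 h')
    have hc := hg u w hadj
    simp only [toggle]
    by_cases hu : u ∈ C <;> by_cases hw : w ∈ C <;> simp only [hu, hw, if_true, if_false]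
    · exact key₁ _ _ hc
    · exact key₂ _ _ (hout w (hclosed u w hadj hu hw)) hc
    · exact (key₂ _ _ (hout u (hclosed w u hadj.symm hw hu)) hc.symm).symm
    · exact hc
  · intro u hu
    have hur : u ≠ r := by
      rintro rfl
      obtain ⟨_, h⟩ := (hmem u).1 hu
      exact h (SimpleGraph.Reachable.refl _)
    rcases hstate σ hσ u hu with h | h <;> simp [h, rootWeight, Fin.val_inj, hur]

/-- A connected dominating set contributes the product of its weights. -/
theorem sum_fiber_of_connected (x : ℕ → R) {r : Fin n} {S : Finset (Fin n)} (hr : r ∈ S)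
    (hdom : IsDominating H S) (hconn : (H.induce (S : Set (Fin n))).Connected) :
    ∑ σ ∈ fiber S, contribution H x r σ = ∏ u ∈ S, x u := by
  classical
  -- The only contributing assignment: state `0` spreads from the root along walks in `S`, and each
  -- vertex outside has a neighbor in state `0`, which rules out `2`.
  set σ₀ : Fin n → Fin 4 := fun u => if u ∈ S then 0 else 3 with hσ₀
  have hmem₀ : σ₀ ∈ fiber S := by
    rw [mem_fiber]
    intro u
    by_cases hu : u ∈ S <;> simp [hσ₀, hu]
  rw [sum_eq_single_of_mem σ₀ hmem₀]
  · have hg : Good H σ₀ := by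
      intro u w _
      by_cases hu : u ∈ S <;> by_cases hw : w ∈ S <;> simp only [hσ₀, hu, hw, if_true, if_false] <;>
        decide
    rw [contribution, if_pos hg, ← prod_subset (subset_univ S)]
    · refine prod_congr rfl fun u hu => ?_
      simp [rootWeight, hσ₀, hu]
    · intro u _ hu
      have hur : u ≠ r := by rintro rfl; exact hu hr
      simp [rootWeight, hσ₀, hu, Fin.val_inj, hur]
  · intro σ hσ hne
    by_contra h
    rw [contribution] at h
    have hg : Good H σ := by by_contra hg; simp [hg] at h
    rw [if_pos hg] at h
    rw [mem_fiber] at hσ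
    have hroot : σ r = 0 := by
      by_contra h0
      refine h (prod_eq_zero (mem_univ r) ?_)
      rw [rootWeight, if_pos ⟨rfl, fun h' => h0 (Fin.ext h')⟩]
    have hin : ∀ u : (S : Set (Fin n)), σ u = 0 := by
      intro u
      obtain ⟨p⟩ := hconn.preconnected ⟨r, hr⟩ u
      have key : ∀ s : Fin 4, (s : ℕ) < 2 → Compatible 0 s → s = 0 := by decide
      suffices ∀ a b : (S : Set (Fin n)), (H.induce (S : Set (Fin n))).Walk a b → σ a = 0 →
          σ b = 0 from this _ _ p hroot
      intro a b p
      induction p with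
      | nil => exact id
      | @cons a b c hab _ ih =>
        intro ha
        have hc := hg _ _ (show H.Adj a b from hab)
        rw [ha] at hc
        exact ih (key _ ((hσ b).2 b.2) hc)
    refine hne (funext fun u => ?_)
    by_cases hu : u ∈ S
    · simpa [hσ₀, hu] using hin ⟨u, hu⟩
    · obtain ⟨w, hw, hadj⟩ := hdom u hu
      have hc := hg w u hadj.symm
      rw [hin ⟨w, hw⟩] at hc
      have key : ∀ s : Fin 4, ¬ (s : ℕ) < 2 → Compatible 0 s → s = 3 := by decide
      simpa [hσ₀, hu] using key _ (fun h' => hu ((hσ u).1 h')) hc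

/-- `S` is a connected dominating set that contains `r`. -/
def IsRootedCDS (H : SimpleGraph (Fin n)) (r : Fin n) (S : Finset (Fin n)) : Prop :=
  r ∈ S ∧ IsDominating H S ∧ (H.induce (S : Set (Fin n))).Connected

open Classical in
theorem partition_eq (h2 : (2 : R) = 0) (x : ℕ → R) (r : Fin n) :
    partition (natAdj H) n (rootWeight x r) =
      ∑ S with IsRootedCDS H r S, ∏ u ∈ S, x u := by
  rw [partition_eq_sum H h2, ← sum_fiberwise univ chosen, sum_filter]
  refine Fintype.sum_congr _ _ fun S => ?_
  change ∑ σ ∈ fiber S, _ = _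
  by_cases hr : r ∈ S
  · by_cases hdom : IsDominating H S
    · by_cases hconn : (H.induce (S : Set (Fin n))).Connected
      · rw [if_pos ⟨hr, hdom, hconn⟩, sum_fiber_of_connected x hr hdom hconn]
      · rw [if_neg fun h => hconn h.2.2, sum_fiber_of_not_connected h2 x hr hconn]
    · rw [if_neg fun h => hdom h.2.1, sum_fiber_of_not_dominating h2 x hr hdom]
  · rw [if_neg fun h => hr h.1]
    -- If `r` is not chosen, its state is not `0` and the root factor vanishes.
    refine sum_eq_zero fun σ hσ => ?_
    rw [contribution]
    split_ifs
    · refine prod_eq_zero (mem_univ r) ?_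
      rw [rootWeight, if_pos]
      refine ⟨rfl, fun h => hr ((mem_fiber.1 hσ r).1 (by omega))⟩
    · rfl

end CharTwo

open Polynomial

/-! ### Packing polynomials into numbers -/

/-- With coefficients below `β` no carries occur; dividing by `β` and discarding the remainder
corresponds to `divX`. -/
theorem eval_div_pow_mod {β : ℕ} (p : ℕ[X]) (hp : ∀ i, p.coeff i < β) (e : ℕ) :
    p.eval β / β ^ e % β = p.coeff e := by
  have hβ : 0 < β := (Nat.zero_le _).trans_lt (hp 0)
  have key : ∀ p : ℕ[X], p.eval β = β * p.divX.eval β + p.coeff 0 := by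
    intro p
    conv_lhs => rw [← p.divX_mul_X_add]
    simp [mul_comm]
  induction e generalizing p with
  | zero => rw [pow_zero, Nat.div_one, key, Nat.mul_add_mod, Nat.mod_eq_of_lt (hp 0)]
  | succ e ih =>
    rw [pow_succ', ← Nat.div_div_eq_div_mul, key, Nat.mul_add_div hβ, Nat.div_eq_of_lt (hp 0),
      add_zero, ih _ fun i => by rw [coeff_divX]; exact hp _, coeff_divX]

theorem coeff_le_eval_one (p : ℕ[X]) (i : ℕ) : p.coeff i ≤ p.eval 1 := by
  rw [eval_eq_sum_range]
  by_cases hi : i ≤ p.natDegree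
  · simpa using single_le_sum (f := fun i => p.coeff i) (fun _ _ => Nat.zero_le _)
      (mem_range.2 (Nat.lt_succ_of_le hi))
  · rw [coeff_eq_zero_of_natDegree_lt (by omega)]
    exact Nat.zero_le _

/-! ### Transport of the partition function along ring homomorphisms -/

section Map

variable {R S : Type*} [CommSemiring R] [CommSemiring S] (φ : R →+* S)

theorem map_partition (adj : ℕ → ℕ → Prop) (n : ℕ) (W : ℕ → ℕ → R) :
    φ (partition adj n W) = partition adj n fun u s => φ (W u s) := by
  simp [partition, map_stateSum]

theorem map_rootWeight (x : ℕ → R) (r u s : ℕ) :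
    φ (rootWeight x r u s) = rootWeight (fun u => φ (x u)) r u s := by
  unfold rootWeight
  split_ifs <;> simp

theorem map_horner (β : R) (f : ℕ → Bool) (j : ℕ) :
    φ (horner β f j) = horner (φ β) f j := by
  induction j with
  | zero => simp [horner]
  | succ j ih => simp [horner, ih]

end Map

/-- The random weight of a vertex, as a polynomial in the base. -/
noncomputable def polyWeight (R : Type*) [CommSemiring R] (n : ℕ) (ω : ℕ → Bool) (u : ℕ) : R[X] :=
  horner X (fun j => ω (u * n + j)) n * X ^ (n * n)

theorem partition_le {adj : ℕ → ℕ → Prop} {n B : ℕ} {W : ℕ → ℕ → ℕ} (hW : ∀ u s, W u s ≤ B) :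
    partition adj n W ≤ 4 ^ n * (B ^ n * 3 ^ (n * n)) := by
  refine stateSum_le fun σ => ?_
  have := entry_le (t := 0) (v := n) (D := doneEdges adj n n 0) (slots := fun _ => none) (σ := σ)
    hW 0
  rw [entry, range_zero, prod_empty, mul_one] at this
  exact this.trans (Nat.mul_le_mul_left _ (Nat.pow_le_pow_right (by norm_num)
    (card_doneEdges_le _ _ _ _)))

theorem horner_one_le (f : ℕ → Bool) (j : ℕ) : horner 1 f j ≤ j := by
  induction j with
  | zero => simp [horner]
  | succ j ih =>
    have := Bool.toNat_le (f j)
    simp only [horner, Nat.cast_id]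
    omega

/-- Coefficients in `ℕ` are at most the value at `1`, where every weight is at most `n ≤ 2 ^ n`.
Bounding `3` by `4` in the general estimate leads to the exponent in `base`. -/
theorem coeff_partition_lt (adj : ℕ → ℕ → Prop) (n : ℕ) (ω : ℕ → Bool) (r i : ℕ) :
    (partition adj n (rootWeight (polyWeight ℕ n ω) r)).coeff i < base n := by
  refine (coeff_le_eval_one _ i).trans_lt ?_
  rw [← coe_evalRingHom, map_partition]
  refine (partition_le (B := 2 ^ n) fun u s => ?_).trans_lt ?_
  · rw [map_rootWeight, rootWeight]
    split_ifs
    · exact Nat.zero_le _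
    · rw [polyWeight, map_mul, map_horner]
      simpa using (horner_one_le _ n).trans n.lt_two_pow_self.le
    · exact Nat.one_le_two_pow
  · calc 4 ^ n * ((2 ^ n) ^ n * 3 ^ (n * n)) ≤ (2 ^ 2) ^ n * ((2 ^ n) ^ n * (2 ^ 2) ^ (n * n)) := by
          gcongr <;> norm_num
      _ = 2 ^ (2 * n + (n * n + 2 * (n * n))) := by
          rw [← pow_mul, ← pow_mul, ← pow_mul, ← pow_add, ← pow_add]
      _ < 2 ^ (4 * ((n + 1) * (n + 1))) := Nat.pow_lt_pow_right (by norm_num) (by nlinarith)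
      _ = base n := by rw [pow_mul]; rfl

/-- One polynomial over `ℕ` has both sides as images, by evaluation at the base and by reduction
modulo 2. The base is even, so the quotient and its last digit have the same parity. -/
theorem partition_div_pow_mod_two (adj : ℕ → ℕ → Prop) (n : ℕ) (ω : ℕ → Bool) (r e : ℕ) :
    partition adj n (rootWeight (packedWeight n ω) r) / base n ^ e % 2 ≠ 0 ↔
      (partition adj n (rootWeight (polyWeight (ZMod 2) n ω) r)).coeff e ≠ 0 := by
  set p := partition adj n (rootWeight (polyWeight ℕ n ω) r) with hp
  have h₁ : partition adj n (rootWeight (packedWeight n ω) r) = p.eval (base n) := by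
    rw [← coe_evalRingHom, hp, map_partition]
    congr 1
    funext u s
    rw [map_rootWeight]
    congr 1
    funext u
    rw [polyWeight, map_mul, map_horner]
    simp [packedWeight]
  have h₂ : partition adj n (rootWeight (polyWeight (ZMod 2) n ω) r) =
      p.map (Nat.castRingHom (ZMod 2)) := by
    rw [← coe_mapRingHom, hp, map_partition]
    congr 1
    funext u s
    rw [map_rootWeight]
    congr 1
    funext u
    rw [polyWeight, polyWeight, map_mul, map_horner]
    simp
  have heven : 2 ∣ base n := dvd_pow (by norm_num) (by positivity)
  rw [h₁, h₂, coeff_map, ← eval_div_pow_mod p (coeff_partition_lt adj n ω r) e, eq_natCast, ne_eq,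
    ne_eq, ZMod.natCast_eq_zero_iff, Nat.dvd_iff_mod_eq_zero, Nat.mod_mod_of_dvd _ heven]

/-! ### Which coefficients are odd -/

section Coefficients

variable {n : ℕ} {H : SimpleGraph (Fin n)} {ω : ℕ → Bool} {r : Fin n}

/-- The unshifted random weight of a vertex. -/
noncomputable def randomWeight (n : ℕ) (ω : ℕ → Bool) (u : ℕ) : (ZMod 2)[X] :=
  horner X (fun j => ω (u * n + j)) n

theorem natDegree_horner (f : ℕ → Bool) (j : ℕ) :
    (horner (X : (ZMod 2)[X]) f j).natDegree ≤ j - 1 := by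
  induction j with
  | zero => simp [horner]
  | succ j ih =>
    rw [horner, Nat.add_sub_cancel]
    refine natDegree_add_le_of_degree_le ?_ ((natDegree_natCast _).trans_le (Nat.zero_le _))
    cases j with
    | zero => simp [horner]
    | succ j => exact natDegree_mul_le.trans (by rw [natDegree_X]; omega)

/-- This makes `n * n` a sufficient shift to keep different cardinalities apart. -/
theorem natDegree_prod_randomWeight_lt (hn : 0 < n) (S : Finset (Fin n)) :
    (∏ u ∈ S, randomWeight n ω u).natDegree < n * n := by
  have hcard : S.card ≤ n := by simpa using card_le_univ S
  calc _ ≤ ∑ u ∈ S, (randomWeight n ω u).natDegree := natDegree_prod_le _ _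
    _ ≤ S.card * (n - 1) := by
      simpa [randomWeight] using sum_le_card_nsmul S _ (n - 1) fun u _ => natDegree_horner _ n
    _ ≤ n * (n - 1) := Nat.mul_le_mul_right _ hcard
    _ < n * n := Nat.mul_lt_mul_of_pos_left (by omega) hn

open Classical in
theorem partition_polyWeight :
    partition (natAdj H) n (rootWeight (polyWeight (ZMod 2) n ω) r) =
      ∑ S with IsRootedCDS H r S,
        (∏ u ∈ S, randomWeight n ω u) * X ^ (S.card * (n * n)) := by
  rw [partition_eq (by rw [← C_ofNat, show (OfNat.ofNat 2 : ZMod 2) = 0 from rfl, C_0])]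
  refine sum_congr rfl fun S _ => ?_
  simp only [polyWeight, prod_mul_distrib, prod_const, randomWeight]
  rw [← pow_mul, mul_comm (n * n)]

/-- The reason why there are no false positives: a nonzero sum has a nonzero summand, whatever the
coins. -/
theorem exists_of_coeff_ne_zero {e : ℕ}
    (h : (partition (natAdj H) n (rootWeight (polyWeight (ZMod 2) n ω) r)).coeff e ≠ 0) :
    ∃ S, IsRootedCDS H r S ∧ S.card * (n * n) ≤ e := by
  classical
  rw [partition_polyWeight, finsetSum_coeff] at h
  obtain ⟨S, hS, hne⟩ := exists_ne_zero_of_sum_ne_zero h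
  refine ⟨S, (mem_filter.1 hS).2, ?_⟩
  by_contra hlt
  rw [coeff_mul_X_pow', if_neg hlt] at hne
  exact hne rfl

open Classical in
/-- The contribution of the rooted connected dominating sets of cardinality `j`. -/
noncomputable def layer (H : SimpleGraph (Fin n)) (r : Fin n) (j : ℕ) (ω : ℕ → Bool) :
    (ZMod 2)[X] :=
  ∑ S with IsRootedCDS H r S ∧ S.card = j, ∏ u ∈ S, randomWeight n ω u

theorem exists_coeff_ne_zero {j : ℕ} (h : layer H r j ω ≠ 0) : ∃ i < n * n,
    (partition (natAdj H) n (rootWeight (polyWeight (ZMod 2) n ω) r)).coeff (j * (n * n) + i) ≠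
      0 := by
  classical
  have hn : 0 < n := r.pos
  obtain ⟨i, hi⟩ : ∃ i, (layer H r j ω).coeff i ≠ 0 := by
    by_contra hcon
    push Not at hcon
    exact h (Polynomial.ext hcon)
  have hin : i < n * n := by
    rw [layer, finsetSum_coeff] at hi
    obtain ⟨S, -, hne⟩ := exists_ne_zero_of_sum_ne_zero hi
    exact (le_natDegree_of_ne_zero hne).trans_lt (natDegree_prod_randomWeight_lt hn S)
  refine ⟨i, hin, ?_⟩
  convert hi using 1
  rw [partition_polyWeight, layer, finsetSum_coeff, finsetSum_coeff, ← filter_filter,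
    sum_filter (fun S : Finset (Fin n) => S.card = j)]
  refine sum_congr rfl fun S _ => ?_
  rw [coeff_mul_X_pow']
  -- Smaller sets have too small a degree to reach block `j`, larger ones start after it.
  rcases lt_trichotomy S.card j with hlt | rfl | hlt
  · rw [if_neg hlt.ne, ite_eq_right_iff]
    intro _
    refine coeff_eq_zero_of_natDegree_lt ((natDegree_prod_randomWeight_lt hn S).trans_le ?_)
    have := Nat.mul_le_mul_right (n * n) hlt
    rw [Nat.succ_mul] at this
    omega
  · rw [if_pos (by omega), if_pos rfl, Nat.add_sub_cancel_left]
  · rw [if_neg hlt.ne', if_neg]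
    have := Nat.mul_le_mul_right (n * n) hlt
    rw [Nat.succ_mul] at this
    omega

end Coefficients

/-! ### The probability of a failure -/

section Probability

variable {n : ℕ} {H : SimpleGraph (Fin n)} {r : Fin n}

theorem horner_congr {R : Type*} [Semiring R] (β : R) {f g : ℕ → Bool} {j : ℕ}
    (h : ∀ i < j, f i = g i) : horner β f j = horner β g j := by
  induction j with
  | zero => rfl
  | succ j ih => rw [horner, horner, ih fun i hi => h i (by omega), h j (by omega)]

theorem horner_X_inj {f g : ℕ → Bool} {j : ℕ}
    (h : horner (X : (ZMod 2)[X]) f j = horner X g j) : ∀ i < j, f i = g i := by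
  induction j with
  | zero => intro i hi; omega
  | succ j ih =>
    rw [horner, horner] at h
    have h₀ := congrArg (fun p => p.coeff 0) h
    simp only [coeff_add, mul_coeff_zero, coeff_X_zero, mul_zero, zero_add,
      coeff_natCast_ite, if_true] at h₀
    have hj : f j = g j := by
      revert h₀
      cases f j <;> cases g j <;> simp
    rw [hj] at h
    have h₁ := mul_right_cancel₀ X_ne_zero (add_right_cancel h)
    intro i hi
    rcases Nat.lt_succ_iff_lt_or_eq.1 hi with hi | rfl
    · exact ih h₁ i hi
    · exact hj

/-- The polynomial with coefficients from `c`. -/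
noncomputable def rowPoly (c : Fin n → Bool) : (ZMod 2)[X] :=
  horner X (fun j => if h : j < n then c ⟨j, h⟩ else false) n

theorem rowPoly_injective : Function.Injective (rowPoly (n := n)) := by
  intro c d h
  funext i
  simpa using horner_X_inj h i i.2

/-- The coin tosses that determine the weights. -/
def coins (n : ℕ) (ω : ℕ → Bool) (u j : Fin n) : Bool := ω (u * n + j)

theorem randomWeight_eq (ω : ℕ → Bool) (u : Fin n) :
    randomWeight n ω u = rowPoly (coins n ω u) :=
  horner_congr _ fun i hi => by simp [hi, coins]

open Classical in
/-- The polynomial whose values are the layers. -/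
noncomputable def layerPoly (H : SimpleGraph (Fin n)) (r : Fin n) (j : ℕ) :
    MvPolynomial (Fin n) (ZMod 2)[X] :=
  ∑ S with IsRootedCDS H r S ∧ S.card = j, ∏ u ∈ S, MvPolynomial.X u

theorem layer_eq_eval (j : ℕ) (ω : ℕ → Bool) :
    layer H r j ω = MvPolynomial.eval (fun u => rowPoly (coins n ω u)) (layerPoly H r j) := by
  simp [layer, layerPoly, randomWeight_eq]

/-- At the indicator of `S` only the monomial of `S` survives, since any other set of the same
cardinality has an element outside `S`. -/
theorem layerPoly_ne_zero {S : Finset (Fin n)} (hS : IsRootedCDS H r S) :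
    layerPoly H r S.card ≠ 0 := by
  classical
  intro h
  have := congrArg (MvPolynomial.eval fun u => if u ∈ S then (1 : (ZMod 2)[X]) else 0) h
  rw [layerPoly, map_sum, sum_eq_single_of_mem S (by simp [hS])] at this
  · rw [map_prod, prod_eq_one fun u hu => by simp [hu], map_zero] at this
    exact one_ne_zero this
  · intro T hT hne
    have hcard := (mem_filter.1 hT).2.2
    obtain ⟨u, huT, huS⟩ : ∃ u ∈ T, u ∉ S := by
      by_contra hcon
      push Not at hcon
      exact hne (eq_of_subset_of_card_le hcon hcard.ge)
    rw [map_prod]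
    exact prod_eq_zero huT (by simp [huS])

theorem totalDegree_layerPoly_le (j : ℕ) : (layerPoly H r j).totalDegree ≤ j := by
  classical
  refine MvPolynomial.totalDegree_finsetSum_le fun S hS => ?_
  refine (MvPolynomial.totalDegree_finsetProd _ _).trans ?_
  simp [(mem_filter.1 hS).2.2]

theorem two_mul_le_two_pow (n : ℕ) : 2 * n ≤ 2 ^ n := by
  cases n with
  | zero => simp
  | succ n =>
    have : n < 2 ^ n := n.lt_two_pow_self
    rw [pow_succ]
    omega

open Classical in
/-- The outcomes of the coin tosses for which a layer vanishes. -/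
noncomputable def failures (H : SimpleGraph (Fin n)) (r : Fin n) (j : ℕ) :
    Finset (Fin n → Fin n → Bool) :=
  univ.filter fun c => MvPolynomial.eval (fun u => rowPoly (c u)) (layerPoly H r j) = 0

/-- Schwartz-Zippel on the grid of all `2 ^ n` row polynomials: the degree is at most `n`, and `2 *
n ≤ 2 ^ n`. Injectivity of `rowPoly` turns grid points back into coin outcomes. -/
theorem two_mul_card_failures_le {S : Finset (Fin n)} (hS : IsRootedCDS H r S) :
    2 * (failures H r S.card).card ≤ 2 ^ (n * n) := by
  classical
  set T : Finset (ZMod 2)[X] := univ.image (rowPoly (n := n)) with hT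
  have hcardT : T.card = 2 ^ n := by
    rw [hT, card_image_of_injective _ rowPoly_injective]; simp
  have hsz := MvPolynomial.schwartz_zippel_totalDegree (layerPoly_ne_zero hS) T
  set Z := (Fintype.piFinset fun _ : Fin n => T).filter
    fun f => MvPolynomial.eval f (layerPoly H r S.card) = 0 with hZ
  have hle : (failures H r S.card).card ≤ Z.card := by
    refine card_le_card_of_injOn (fun c u => rowPoly (c u)) (fun c hc => ?_)
      (fun c _ d _ h => funext fun u => rowPoly_injective (congrFun h u))
    have := (mem_filter.1 hc).2
    rw [mem_coe, hZ, mem_filter, Fintype.mem_piFinset]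
    exact ⟨fun u => mem_image_of_mem _ (mem_univ _), this⟩
  have hn : 2 * (layerPoly H r S.card).totalDegree ≤ 2 ^ n := by
    have := totalDegree_layerPoly_le (H := H) (r := r) S.card
    have := card_le_univ S
    have := two_mul_le_two_pow n
    simp only [Fintype.card_fin] at *
    omega
  have hpos : (0 : ℚ≥0) < 2 ^ n := by positivity
  rw [hcardT, div_le_div_iff₀ (by positivity) (by positivity)] at hsz
  have hsz' : Z.card * 2 ^ n ≤ (layerPoly H r S.card).totalDegree * (2 ^ n) ^ n := by
    exact_mod_cast hsz
  have : 2 * Z.card * 2 ^ n ≤ 2 ^ (n * n) * 2 ^ n := by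
    rw [pow_mul]
    calc 2 * Z.card * 2 ^ n = 2 * (Z.card * 2 ^ n) := by ring
      _ ≤ 2 * ((layerPoly H r S.card).totalDegree * (2 ^ n) ^ n) := Nat.mul_le_mul_left _ hsz'
      _ = (2 * (layerPoly H r S.card).totalDegree) * (2 ^ n) ^ n := by ring
      _ ≤ 2 ^ n * (2 ^ n) ^ n := Nat.mul_le_mul_right _ hn
      _ = _ := by ring
  have := Nat.le_of_mul_le_mul_right this (by positivity)
  omega

theorem coinMeasure_coins (c : Fin n → Fin n → Bool) :
    coinMeasure {ω | coins n ω = c} ≤ (2⁻¹ : ENNReal) ^ (n * n) := by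
  -- Quotient and remainder by `n` recover vertex and coin, so the event lies in a cylinder fixing
  -- the first `n * n` tosses.
  set c' : ℕ → Bool := fun i => if h : 0 < n ∧ i < n * n then
    c ⟨i / n, Nat.div_lt_of_lt_mul h.2⟩ ⟨i % n, Nat.mod_lt _ h.1⟩ else false with hc'
  have hsub : {ω | coins n ω = c} ⊆ Set.pi (range (n * n)) fun i => {c' i} := by
    rintro ω rfl i hi
    have hi' : i < n * n := by simpa using hi
    have hn : 0 < n := Nat.pos_of_ne_zero (by rintro rfl; simp at hi')
    simp [hc', hn, hi', coins, Nat.div_add_mod']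
  refine (MeasureTheory.measure_mono hsub).trans ?_
  rw [coinMeasure, MeasureTheory.Measure.infinitePi_pi _ fun _ _ => MeasurableSet.of_discrete]
  refine (Finset.prod_le_pow_card _ _ 2⁻¹ fun i _ => ?_).trans (by simp)
  rw [PMF.toMeasure_apply_singleton _ _ (MeasurableSet.of_discrete)]
  simp

/-- Union bound over the bad tables of `n * n` coins. Only monotonicity and subadditivity enter, so
the event need not be shown measurable. -/
theorem coinMeasure_failures_le {S : Finset (Fin n)} (hS : IsRootedCDS H r S) :
    coinMeasure {ω | layer H r S.card ω = 0} ≤ 1 / 2 := by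
  have hsub : {ω | layer H r S.card ω = 0} ⊆
      ⋃ c ∈ failures H r S.card, {ω | coins n ω = c} := by
    intro ω hω
    rw [Set.mem_ofPred_eq, layer_eq_eval] at hω
    simpa [failures] using hω
  refine (MeasureTheory.measure_mono hsub).trans
    ((MeasureTheory.measure_biUnion_finset_le _ _).trans ?_)
  refine (sum_le_card_nsmul _ _ _ fun c _ => coinMeasure_coins c).trans ?_
  have h := two_mul_card_failures_le hS
  have h' : (2 : ENNReal) * (failures H r S.card).card ≤ 2 ^ (n * n) := by exact_mod_cast h
  rw [nsmul_eq_mul, ENNReal.inv_pow.symm, ← div_eq_mul_inv, one_div]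
  refine ENNReal.div_le_of_le_mul ?_
  rw [← ENNReal.div_eq_inv_mul, ENNReal.le_div_iff_mul_le (by simp) (by simp), mul_comm]
  exact h'

end Probability

/-! ### The input of the algorithm -/

theorem HasCDS.of_iso {n n' : ℕ} {G : SimpleGraph (Fin n)} {G' : SimpleGraph (Fin n')}
    (e : G ≃g G') {k : ℤ} (h : HasCDS G k) : HasCDS G' k := by
  obtain ⟨S, hdom, hcard, hconn⟩ := h
  refine ⟨S.map e.toEquiv.toEmbedding, ?_, by simpa using hcard, ?_⟩
  · intro v hv
    obtain ⟨u, hu, hadj⟩ := hdom (e.symm v) fun h => hv (mem_map.2 ⟨_, h, by simp⟩)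
    refine ⟨e u, mem_map_of_mem _ hu, ?_⟩
    have := e.map_adj_iff.2 hadj
    simpa using this
  · let f : G.induce (S : Set (Fin n)) →g
        G'.induce ((S.map e.toEquiv.toEmbedding : Finset (Fin n')) : Set (Fin n')) :=
      ⟨fun u => ⟨e u.1, mem_coe.2 (mem_map_of_mem _ u.2)⟩, fun {a b} h => e.map_adj_iff.2 h⟩
    refine hconn.map f ?_
    rintro ⟨v, hv⟩
    obtain ⟨u, hu, rfl⟩ := mem_map.1 (mem_coe.1 hv)
    exact ⟨⟨u, hu⟩, rfl⟩

section Input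

variable {n : ℕ} (G : SimpleGraph (Fin n)) (ℓ : Equiv.Perm (Fin n)) (k : ℤ)

/-- The graph on the positions of the linear arrangement. -/
def positionGraph : SimpleGraph (Fin n) := G.comap ℓ

/-- The positions carry the same graph. -/
def positionIso : positionGraph G ℓ ≃g G := SimpleGraph.Iso.comap ℓ G

theorem hasCDS_iff : HasCDS G k ↔
    ∃ r S, IsRootedCDS (positionGraph G ℓ) r S ∧ (S.card : ℤ) ≤ k := by
  constructor
  · intro h
    obtain ⟨S, hdom, hcard, hconn⟩ := h.of_iso (positionIso G ℓ).symm
    obtain ⟨r⟩ := hconn.nonempty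
    exact ⟨r, S, ⟨r.2, hdom, hconn⟩, hcard⟩
  · rintro ⟨r, S, ⟨-, hdom, hconn⟩, hcard⟩
    exact HasCDS.of_iso (positionIso G ℓ) ⟨S, hdom, hcard, hconn⟩

theorem ncard_cut_le (i : Fin n) : (cut G ℓ i).ncard ≤ cutwidth G ℓ :=
  le_sup (f := fun i => (cut G ℓ i).ncard) (mem_univ i)

/-- Between two vertices the active edges cross the cut after position `v`, and ordered pairs `e.1 <
e.2` inject into unordered ones. -/
theorem card_activeEdges_le (v : ℕ) (hv : v < n) :
    (activeEdges (natAdj (positionGraph G ℓ)) n (v + 1) 0).card ≤ cutwidth G ℓ := by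
  refine le_trans ?_ (ncard_cut_le G ℓ ⟨v, hv⟩)
  rw [Set.ncard_eq_toFinset_card _ (Set.toFinite _)]
  have hn : 0 < n := by omega
  let f : ℕ → Fin n := fun i => ⟨i % n, Nat.mod_lt _ hn⟩
  have hf : ∀ i (hi : i < n), f i = ⟨i, hi⟩ := fun i hi => Fin.ext (Nat.mod_eq_of_lt hi)
  refine card_le_card_of_injOn (fun e => s(ℓ (f e.1), ℓ (f e.2))) ?_ ?_
  · intro e he
    simp only [coe_filter, activeEdges, mem_product, mem_range, Set.mem_ofPred_eq] at he
    obtain ⟨⟨h₁, h₂⟩, ⟨_, _, hadj⟩, h₃, h₄⟩ := he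
    simp only [Set.Finite.coe_toFinset]
    refine ⟨?_, f e.1, f e.2, ?_, ?_, rfl⟩
    · rw [hf _ h₁, hf _ h₂]; exact hadj
    · rw [hf _ h₁, Fin.mk_le_mk]; omega
    · rw [hf _ h₂, Fin.mk_lt_mk]; omega
  · intro e he e' he' heq
    simp only [coe_filter, activeEdges, mem_product, mem_range, Set.mem_ofPred_eq] at he he'
    simp only [hf _ he.1.1, hf _ he.1.2, hf _ he'.1.1, hf _ he'.1.2, Sym2.eq_iff,
      ℓ.injective.eq_iff, Fin.mk.injEq] at heq
    have := he.2.2.1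
    have := he'.2.2.1
    exact Prod.ext (by omega) (by omega)

/-- A crude bound, used to make the word length `bits` depend on `n` and `k` only. -/
theorem cutwidth_le : cutwidth G ℓ ≤ n * n := by
  refine Finset.sup_le fun i _ => ?_
  refine (Set.ncard_le_card _).trans ?_
  rw [Nat.card_eq_fintype_card, Sym2.card, Fintype.card_fin, Nat.choose_two_right,
    Nat.add_sub_cancel]
  refine Nat.div_le_of_le_mul ?_
  rcases Nat.eq_zero_or_pos n with rfl | hn
  · simp
  · nlinarith

theorem represents_input :
    Represents n (natAdj (positionGraph G ℓ)) (input G ℓ k) where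
  order := rfl
  adj u hu w hw := by
    have h₂ : ∀ i (hi : i < n), input G ℓ k 2 i = ℓ ⟨i, hi⟩ := fun i hi => by simp [input, hi]
    rw [h₂ u hu, h₂ w hw]
    simp only [input, ne_eq, ite_eq_right_iff, one_ne_zero, imp_false, not_not]
    constructor
    · rintro ⟨a, b, heq, hadj⟩
      rw [mul_comm n] at heq
      obtain ⟨h, h'⟩ := mul_add_inj (ℓ ⟨w, hw⟩).2 b.2 heq
      refine ⟨hu, hw, ?_⟩
      change G.Adj (ℓ ⟨u, hu⟩) (ℓ ⟨w, hw⟩)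
      rwa [Fin.ext h, Fin.ext h']
    · rintro ⟨_, _, hadj⟩
      exact ⟨_, _, by rw [mul_comm], hadj⟩

/-- The number of bits that suffice for all numbers in the computation. -/
def bits (n : ℕ) (k : ℤ) : ℕ := 16 * (n + 1) ^ 5 + k.natAbs.size

theorem base_eq (n : ℕ) : base n = 2 ^ (4 * ((n + 1) * (n + 1))) := by
  rw [pow_mul]; rfl

theorem fits {t : ℕ} (ht : t ≤ n * n) : Fits (bits n k) n t := by
  have hlow : ∀ x, x ≤ 16 * (n + 1) ^ 5 → (2 : ℕ) ^ x ≤ 2 ^ bits n k := fun x hx =>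
    Nat.pow_le_pow_right (by norm_num) (hx.trans (Nat.le_add_right _ _))
  have key : ∀ y x, y ≤ 2 ^ x → x + 1 ≤ 16 * (n + 1) ^ 5 → y < 2 ^ bits n k := fun y x hy hx =>
    (hy.trans_lt (Nat.pow_lt_pow_right (by norm_num) (Nat.lt_succ_self _))).trans_le (hlow _ hx)
  have hself : ∀ y, y + 1 ≤ 16 * (n + 1) ^ 5 → y < 2 ^ bits n k := fun y hy =>
    key y y y.lt_two_pow_self.le hy
  have h3 : ∀ m, 3 ^ m ≤ 2 ^ (2 * m) := fun m => by
    rw [pow_mul]; exact Nat.pow_le_pow_left (by norm_num) _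
  -- Bit length of the largest table entries: products of `n` packed weights. This dictates the
  -- fifth power in `bits`.
  have hexp : 4 * ((n + 1) * (n + 1)) * (n + n * n) * n + 2 * n + 2 * (n * n) + 1 ≤
      16 * (n + 1) ^ 5 := by ring_nf; omega
  refine ⟨?_, ?_, ?_, ?_, ?_, ?_⟩
  · exact key _ _ (base_eq n).le (by ring_nf; nlinarith)
  · refine key _ _ (by rw [base_eq, ← pow_mul]) ?_
    ring_nf; nlinarith
  · exact hself _ (by ring_nf; nlinarith)
  · exact hself _ (by ring_nf; nlinarith)
  · refine key _ (4 + 2 * (n * n)) ?_ (by ring_nf; nlinarith)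
    rw [pow_add]
    refine Nat.mul_le_mul (by norm_num) ((h3 t).trans ?_)
    exact Nat.pow_le_pow_right (by norm_num) (by omega)
  · intro v hv
    refine key _ (2 * v + (4 * ((n + 1) * (n + 1)) * (n + n * n) * v + 2 * (n * n))) ?_ ?_
    · rw [base_eq, ← pow_mul, ← pow_mul, pow_add, pow_add, pow_mul 2 2 v,
        mul_assoc (4 * ((n + 1) * (n + 1))) _ v]
      exact Nat.mul_le_mul_left _ (Nat.mul_le_mul_left _ (h3 _))
    · have := Nat.mul_le_mul_left (4 * ((n + 1) * (n + 1)) * (n + n * n)) hv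
      omega

theorem bounded_input : Bounded (bits n k) (input G ℓ k) := by
  have F := fits (n := n) k (Nat.zero_le (n * n))
  have hn := F.order_lt
  have h1 : 1 < 2 ^ bits n k := Nat.one_lt_two_pow (by have := F.one_le; omega)
  have hk : k.natAbs < 2 ^ bits n k := k.natAbs.lt_size_self.trans_le
    (Nat.pow_le_pow_right (by norm_num) (Nat.le_add_left _ _))
  intro a i
  unfold input
  split
  · exact hn
  · exact hk
  · split_ifs <;> omega
  · split_ifs <;> omega
  · split_ifs with h
    · exact (ℓ ⟨i, h⟩).2.trans hn
    · omega
  · omega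

theorem steps_le (n t : ℕ) : steps n t ≤ 200 * (n + 1) ^ 4 * 3 ^ t := by
  have ht : t ≤ 3 ^ t := (Nat.lt_pow_self (by norm_num)).le
  have h1 : 1 ≤ 3 ^ t := Nat.one_le_pow _ _ (by norm_num)
  calc steps n t ≤ (6 * ((n + 1) * (n + 1)) + 6) + ((n * (4 * n + 6) + 2) +
      (n * ((n * (n * (24 * 3 ^ t + 2 * 3 ^ t + 14) + (15 * 3 ^ t + 8)) + 4) +
        ((n + 1) * (n * n) * 5 + 3) + 2) + 2)) := by
        unfold steps
        gcongr
    _ ≤ 200 * (n + 1) ^ 4 * 3 ^ t := by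
        -- With `3 ^ t = c + 1` the claim becomes a comparison of polynomials with natural
        -- coefficients, monomial by monomial.
        obtain ⟨c, hc⟩ := Nat.exists_eq_add_of_le' h1
        rw [hc]
        ring_nf
        omega

theorem run_main (ω : ℕ → Bool) : ∃ T s, Exec ω .main ⟨input G ℓ k, 0⟩ T s ∧
    T ≤ 200 * (n + 1) ^ 4 * 3 ^ cutwidth G ℓ * (1000 * bits n k) ∧
    (s.mem 3 0 ≠ 0 ↔ ∃ r : Fin n, ∃ e < (n + 1) * (n * n),
      (partition (natAdj (positionGraph G ℓ)) n
        (rootWeight (polyWeight (ZMod 2) n ω) r)).coeff e ≠ 0 ∧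
      e < (k.natAbs + 1) * (n * n) ∧ 0 ≤ k) := by
  have h := Wp.main (ω := ω) (fits k (cutwidth_le G ℓ))
    (adj := natAdj (positionGraph G ℓ)) (fun u w ⟨hu, hw, h⟩ => ⟨hw, hu, h.symm⟩)
    (fun u ⟨_, _, h⟩ => h.ne rfl) (card_activeEdges_le G ℓ) (represents_input G ℓ k)
    (fun i => rfl) rfl (bounded_input G ℓ k)
  obtain ⟨T, s, he, hT, -, hQ⟩ := h
  refine ⟨T, s, he, hT.trans (Nat.mul_le_mul_right _ (steps_le _ _)), hQ.trans ?_⟩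
  have hsign : input G ℓ k 0 2 = 0 ↔ 0 ≤ k := by
    change (if k < 0 then 1 else 0) = 0 ↔ 0 ≤ k
    split_ifs <;> simp_all
  simp only [partition_div_pow_mod_two, hsign]
  exact ⟨fun ⟨r, hr, h⟩ => ⟨⟨r, hr⟩, h⟩, fun ⟨r, h⟩ => ⟨r, r.2, h⟩⟩

theorem accepts_iff (ω : ℕ → Bool) : Accepts .main (input G ℓ k) ω ↔
    ∃ r : Fin n, ∃ e < (n + 1) * (n * n),
      (partition (natAdj (positionGraph G ℓ)) n
        (rootWeight (polyWeight (ZMod 2) n ω) r)).coeff e ≠ 0 ∧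
      e < (k.natAbs + 1) * (n * n) ∧ 0 ≤ k := by
  obtain ⟨T, s, he, -, hs⟩ := run_main G ℓ k ω
  rw [← hs]
  constructor
  · rintro ⟨T', s', he', h⟩
    rwa [(he.unique he').2]
  · exact fun h => ⟨T, s, he, h⟩

end Input

end CutwidthCDS

/-! ### The main theorem -/

theorem mainTheorem3 :
    ∃ (p : CutwidthCDS.Prog) (P : Polynomial ℕ),
      ∀ (n : ℕ) (G : SimpleGraph (Fin n)) (ℓ : Equiv.Perm (Fin n)) (k : ℤ),
        (∀ ω : ℕ → Bool,
          CutwidthCDS.HaltsWithin p (CutwidthCDS.input G ℓ k) ω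
            (P.eval (CutwidthCDS.inputSize n k) * 3 ^ CutwidthCDS.cutwidth G ℓ)) ∧
        (¬ CutwidthCDS.HasCDS G k →
          ∀ ω : ℕ → Bool, ¬ CutwidthCDS.Accepts p (CutwidthCDS.input G ℓ k) ω) ∧
        (CutwidthCDS.HasCDS G k →
          CutwidthCDS.coinMeasure {ω | ¬ CutwidthCDS.Accepts p (CutwidthCDS.input G ℓ k) ω}
            ≤ 1 / 2) := by
  open CutwidthCDS in
  -- The bound of `steps_le` times the time unit `1000 * bits n k`, with `n` and the bit number of
  -- `|k|` both replaced by the input size.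
  refine ⟨.main, 200 * (.X + 1) ^ 4 * (1000 * (16 * (.X + 1) ^ 5 + .X)),
    fun n G ℓ k => ⟨fun ω => ?_, fun hno ω hacc => ?_, fun hyes => ?_⟩⟩
  · obtain ⟨T, s, he, hT, -⟩ := run_main G ℓ k ω
    refine ⟨T, s, he, hT.trans ?_⟩
    simp only [Polynomial.eval_mul, Polynomial.eval_add, Polynomial.eval_pow, Polynomial.eval_X,
      Polynomial.eval_ofNat, Polynomial.eval_one]
    rw [mul_right_comm]
    refine Nat.mul_le_mul_right _ ?_
    have hn : n ≤ inputSize n k := Nat.le_add_right _ _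
    have hk : k.natAbs.size ≤ inputSize n k := Nat.le_add_left _ _
    unfold bits
    gcongr
  · obtain ⟨r, e, -, hne, he, hk⟩ := (accepts_iff G ℓ k ω).1 hacc
    obtain ⟨S, hS, hle⟩ := exists_of_coeff_ne_zero hne
    refine hno ((hasCDS_iff G ℓ k).2 ⟨r, S, hS, ?_⟩)
    -- Cancelling `n * n` leaves `S.card < |k| + 1`, and `|k| = k` by the sign test.
    have := Nat.lt_of_mul_lt_mul_right (hle.trans_lt he)
    omega
  · obtain ⟨r, S, hS, hcard⟩ := (hasCDS_iff G ℓ k).1 hyes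
    refine (MeasureTheory.measure_mono fun ω hω => ?_).trans (coinMeasure_failures_le hS)
    -- A nonzero layer for this one root and cardinality already forces acceptance.
    by_contra hne
    obtain ⟨i, hi, hcoeff⟩ := exists_coeff_ne_zero hne
    refine hω ((accepts_iff G ℓ k ω).2 ⟨r, _, ?_, hcoeff, ?_, by omega⟩)
    · have : S.card ≤ n := by simpa using Finset.card_le_univ S
      nlinarith
    · have : S.card ≤ k.natAbs := by omega
      nlinarith
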